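/- Let $0<\alpha<1$, let $0=t_0<t_1<t_2<\dots$ be an infinite time mesh, and put $\tau_k=t_k-t_{k-1}$ $(k\ge1)$, $\rho_k=\tau_k/\tau_{k-1}$ $(k\ge2)$. Let $\Omega\subset\mathbb R^d$ be measurable. For a function $u:[0,\infty)\times\Omega\to\mathbb R$ put $u^k=u(t_k,\cdot)$ and $\delta_ku=u^k-u^{k-1}$; $\langle\cdot,\cdot\rangle$ and $\|\cdot\|$ are the inner product and the norm of $L^2(\Omega)$. For $j\ge1$ let $H_2^j$ be the quadratic Lagrange polynomial in time interpolating $u^{j-1},u^j,u^{j+1}$ at $t_{j-1},t_j,t_{j+1}$. The L2 fractional-derivative operator is $L_1^\alpha u=\dfrac{u^1-u^0}{\Gamma(2-\alpha)\tau_1^\alpha}$ and, for $k\ge2$, $$L_k^\alpha u=\frac1{\Gamma(1-\alpha)}\Big(\sum_{j=1}^{k-1}\int_{t_{j-1}}^{t_j}\frac{\partial_sH_2^j(s)}{(t_k-s)^\alpha}\,ds+\int_{t_{k-1}}^{t_k}\frac{\partial_sH_2^{k-1}(s)}{(t_k-s)^\alpha}\,ds\Big),$$ and $\mathcal B_n(v,w)=\sum_{k=1}^n\langle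 L_k^\alpha v,\delta_kw\rangle$. *Coefficients.* For $1\le j\le k-1$ let $$a_j^k=\int_{t_{j-1}}^{t_j}\frac{2s-t_j-t_{j+1}}{\tau_j(\tau_j+\tau_{j+1})}\frac{ds}{(t_k-s)^\alpha},\qquad c_j^k=\int_{t_{j-1}}^{t_j}\frac{2s-t_{j-1}-t_j}{\tau_{j+1}(\tau_j+\tau_{j+1})}\frac{ds}{(t_k-s)^\alpha},$$ and for $k\ge2$ let $$a_k^k=\int_{t_{k-1}}^{t_k}\frac{2s-t_{k-1}-t_k}{\tau_{k-1}(\tau_{k-1}+\tau_k)}\frac{ds}{(t_k-s)^\alpha},\qquad c_k^k=\int_{t_{k-1}}^{t_k}\frac{2s-t_{k-2}-t_{k-1}}{\tau_k(\tau_{k-1}+\tau_k)}\frac{ds}{(t_k-s)^\alpha}.$$ Put $d_2^3=c_1^3-a_2^3$, $2\beta_1=-a_1^2$, $2\beta_2=d_2^3+a_1^3-a_1^2$, $$C=\begin{pmatrix}\frac{2}{1-\alpha}\tau_1^{-\alpha}-2\beta_1&-a_2^2\\-a_2^2&2c_1^2+2c_2^2-2\beta_2-a_3^3\end{pmatrix},\qquad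 \hat g(\alpha)=\tfrac12\Big(C_{11}+C_{22}-\sqrt{(C_{11}-C_{22})^2+4C_{12}C_{21}}\Big),$$ and, for $n\ge2$ and $1\le k\le n$, $$g_k(\alpha)=\begin{cases}(2-\alpha)(1-\alpha)\,\hat g(\alpha),&k=1,2,\\[2pt] \dfrac{\alpha}{\tau_k^\alpha}\Big(\dfrac{(1+\alpha)(2-\alpha)}{\alpha}+\dfrac{\rho_{k+1}-1+\alpha}{(1+\rho_{k+1})^\alpha}-\dfrac{2\rho_{k+1}^{2-\alpha}}{1+\rho_{k+1}}-\dfrac{\rho_k(\rho_k-2)}{1+\rho_k}\Big),&3\le k\le n-1,\\[4pt] \dfrac{\alpha}{\tau_n^\alpha}\Big(\dfrac{(1+\alpha)(2-\alpha)}{\alpha}-\dfrac{\rho_n(\rho_n-2)}{1+\rho_n}\Big),&k=n\ne2.\end{cases}$$ *Constants.* Let $\rho_R=\frac{3+\sqrt{17}}2\approx3.5615528$ and let $\rho_L\approx0.4573328$ be the positive root of $\frac{\rho^2(1+\rho)}{1-3\rho^2(1+\rho)}=\rho_R$. Let $\rho_*\approx0.356341$ be the positive root of $\rho(1+\rho)=1-3\rho^2(1+\rho)$,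 let $$\rho^*=\tfrac12\Big[\tfrac{4+3\rho_*}{1+\rho_*}+\sqrt{\big(\tfrac{4+3\rho_*}{1+\rho_*}\big)^2+4\,\tfrac{2+\rho_*}{1+\rho_*}}\Big]\approx4.15536,$$ and let $\xi_1\approx0.45977$ and $\xi_2\approx3.53202$ be the positive roots of $\frac{\rho^2(1+\rho)}{1-3\rho^2(1+\rho)}=\rho^*$ and of $\frac{-\rho^2+4\rho+2}{\rho^2-3\rho-1}=\rho^*$, respectively. **Claim.** Suppose that $\rho_k\in[\rho_L,\rho_R]$ for all $k\ge2$. Then $$\rho_*<\rho_2,\qquad \rho_*<\rho_3<\rho^*,\qquad 2+\frac2{1+\rho_3}+\frac{4\rho_2}{1+\rho_2}-\frac{\rho_2^3}{(1+\rho_2)^2}\ge0,$$ and for every $k\ge3$ we have $\rho_*<\rho_k<\rho^*$ and $$\begin{cases}\rho_*<\rho_{k+1}\le\dfrac{\rho_k^2(1+\rho_k)}{1-3\rho_k^2(1+\rho_k)},&\rho_*<\rho_k<\xi_1,\\[4pt] \rho_*<\rho_{k+1}<\rho^*,&\xi_1\le\rho_k\le\xi_2,\\[2pt] \rho_*<\rho_{k+1}\le\dfrac{-\rho_k^2+4\rho_k+2}{\rho_k^2-3\rho_k-1},&\xi_2<\rho_k<\rho^*.\end{cases}$$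 Consequently, for every $n\ge2$, the numbers $g_1(\alpha),\dots,g_n(\alpha)$ are positive, and for every $u:[0,\infty)\times\Omega\to\mathbb R$ with $u^k\in L^2(\Omega)$ for $0\le k\le n$, $$\mathcal B_n(u,u)=\sum_{k=1}^n\langle L_k^\alpha u,\delta_ku\rangle\ \ge\ \sum_{k=1}^n\frac{g_k(\alpha)}{2\Gamma(3-\alpha)}\,\|\delta_ku\|^2\ \ge\ 0 .$$ -/

import Mathlib

open MeasureTheory

noncomputable section

namespace L2Frac

/-! ### The time mesh -/

/-- The time step `τ_k = t_k - t_{k-1}`, for `k ≥ 1`. -/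
def tau (t : ℕ → ℝ) (k : ℕ) : ℝ := t k - t (k - 1)

/-- The step ratio `ρ_k = τ_k / τ_{k-1}`, for `k ≥ 2`. -/
def rho (t : ℕ → ℝ) (k : ℕ) : ℝ := tau t k / tau t (k - 1)

/-! ### The L2 fractional-derivative operator and the bilinear form -/

/-- The quadratic Lagrange polynomial `H_2^j` interpolating the values `v (j-1)`, `v j`, `v (j+1)`
at the nodes `t (j-1)`, `t j`, `t (j+1)`, for `j ≥ 1`. -/
def quadInterp (t v : ℕ → ℝ) (j : ℕ) (s : ℝ) : ℝ :=
  (s - t j) * (s - t (j + 1)) / ((t (j - 1) - t j) * (t (j - 1) - t (j + 1))) * v (j - 1)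
    + (s - t (j - 1)) * (s - t (j + 1)) / ((t j - t (j - 1)) * (t j - t (j + 1))) * v j
    + (s - t (j - 1)) * (s - t j) / ((t (j + 1) - t (j - 1)) * (t (j + 1) - t j)) * v (j + 1)

/-- The operator `L_k^α`, for `k ≥ 1`, applied to the sequence `v` of grid values. -/
def fracL2 (α : ℝ) (t v : ℕ → ℝ) (k : ℕ) : ℝ :=
  if k = 1 then (v 1 - v 0) / (Real.Gamma (2 - α) * tau t 1 ^ α)
  else 1 / Real.Gamma (1 - α) *
    ((∑ j ∈ Finset.Icc 1 (k - 1),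
        ∫ s in (t (j - 1))..(t j), deriv (quadInterp t v j) s / (t k - s) ^ α)
      + ∫ s in (t (k - 1))..(t k), deriv (quadInterp t v (k - 1)) s / (t k - s) ^ α)

/-- The function `x ↦ (L_k^α u)(x)` for a function `u = u(time, x)`. -/
def fracL2Fun {E : Type*} (α : ℝ) (t : ℕ → ℝ) (u : ℝ → E → ℝ) (k : ℕ) (x : E) : ℝ :=
  fracL2 α t (fun j => u (t j) x) k

/-- The increment `δ_k u = u^k - u^{k-1}`, where `u^k = u(t_k, ·)`, for `k ≥ 1`. -/
def delta {E : Type*} (t : ℕ → ℝ) (u : ℝ → E → ℝ) (k : ℕ) (x : E) : ℝ :=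
  u (t k) x - u (t (k - 1)) x

/-- The inner product of `L²(Ω)`. -/
def l2Inner {d : ℕ} (Ω : Set (EuclideanSpace ℝ (Fin d)))
    (f g : EuclideanSpace ℝ (Fin d) → ℝ) : ℝ :=
  ∫ x in Ω, f x * g x

/-- The norm of `L²(Ω)`. -/
def l2Norm {d : ℕ} (Ω : Set (EuclideanSpace ℝ (Fin d)))
    (f : EuclideanSpace ℝ (Fin d) → ℝ) : ℝ :=
  Real.sqrt (l2Inner Ω f f)

/-- The bilinear form `B_n(v, w) = ∑_{k=1}^n ⟨L_k^α v, δ_k w⟩`. -/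
def bilinB {d : ℕ} (Ω : Set (EuclideanSpace ℝ (Fin d))) (α : ℝ) (t : ℕ → ℝ) (n : ℕ)
    (v w : ℝ → EuclideanSpace ℝ (Fin d) → ℝ) : ℝ :=
  ∑ k ∈ Finset.Icc 1 n, l2Inner Ω (fracL2Fun α t v k) (delta t w k)

/-! ### The coefficients of the operator and the functions `g_k(α)` -/

/-- The coefficient `a_j^k`, for `1 ≤ j ≤ k`, `k ≥ 2`. -/
def coefA (α : ℝ) (t : ℕ → ℝ) (k j : ℕ) : ℝ :=
  if j < k then
    ∫ s in (t (j - 1))..(t j),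
      (2 * s - t j - t (j + 1)) / (tau t j * (tau t j + tau t (j + 1))) * (1 / (t k - s) ^ α)
  else
    ∫ s in (t (k - 1))..(t k),
      (2 * s - t (k - 1) - t k) / (tau t (k - 1) * (tau t (k - 1) + tau t k))
        * (1 / (t k - s) ^ α)

/-- The coefficient `c_j^k`, for `1 ≤ j ≤ k`, `k ≥ 2`. -/
def coefC (α : ℝ) (t : ℕ → ℝ) (k j : ℕ) : ℝ :=
  if j < k then
    ∫ s in (t (j - 1))..(t j),
      (2 * s - t (j - 1) - t j) / (tau t (j + 1) * (tau t j + tau t (j + 1)))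
        * (1 / (t k - s) ^ α)
  else
    ∫ s in (t (k - 1))..(t k),
      (2 * s - t (k - 2) - t (k - 1)) / (tau t k * (tau t (k - 1) + tau t k))
        * (1 / (t k - s) ^ α)

/-- `d_j^k = c_{j-1}^k - a_j^k`. -/
def coefD (α : ℝ) (t : ℕ → ℝ) (k j : ℕ) : ℝ := coefC α t k (j - 1) - coefA α t k j

/-- `β_1 = -a_1^2 / 2`. -/
def beta1 (α : ℝ) (t : ℕ → ℝ) : ℝ := -coefA α t 2 1 / 2

/-- `β_2 = (d_2^3 + a_1^3 - a_1^2) / 2`. -/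
def beta2 (α : ℝ) (t : ℕ → ℝ) : ℝ := (coefD α t 3 2 + coefA α t 3 1 - coefA α t 2 1) / 2

/-- The symmetric `2 × 2` matrix `C`. -/
def matC (α : ℝ) (t : ℕ → ℝ) : Matrix (Fin 2) (Fin 2) ℝ :=
  !![2 * (1 - α)⁻¹ * tau t 1 ^ (-α) - 2 * beta1 α t, -coefA α t 2 2;
     -coefA α t 2 2, 2 * coefC α t 2 1 + 2 * coefC α t 2 2 - 2 * beta2 α t - coefA α t 3 3]

/-- `ĝ(α)`, the smaller eigenvalue of `C`. -/
def gHat (α : ℝ) (t : ℕ → ℝ) : ℝ :=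
  (matC α t 0 0 + matC α t 1 1
    - Real.sqrt ((matC α t 0 0 - matC α t 1 1) ^ 2 + 4 * (matC α t 0 1 * matC α t 1 0))) / 2

/-- The functions `g_k(α)`, `1 ≤ k ≤ n` (they also depend on `n` and on the mesh). -/
def g (α : ℝ) (t : ℕ → ℝ) (n k : ℕ) : ℝ :=
  if k ≤ 2 then (2 - α) * (1 - α) * gHat α t
  else if k < n then
    α / tau t k ^ α *
      ((1 + α) * (2 - α) / α
        + (rho t (k + 1) - 1 + α) / (1 + rho t (k + 1)) ^ α
        - 2 * rho t (k + 1) ^ (2 - α) / (1 + rho t (k + 1))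
        - rho t k * (rho t k - 2) / (1 + rho t k))
  else
    α / tau t k ^ α *
      ((1 + α) * (2 - α) / α - rho t k * (rho t k - 2) / (1 + rho t k))

/-! ### The constants in the constraints on the step ratios -/

theorem existsUnique_cubic {y : ℝ} (hy : 0 < y) :
    ∃! r : ℝ, 0 < r ∧ r ^ 2 * (1 + r) / (1 - 3 * r ^ 2 * (1 + r)) = y := by
  have key : ∀ r : ℝ, r ^ 2 * (1 + r) / (1 - 3 * r ^ 2 * (1 + r)) = y ↔
      r ^ 2 * (1 + r) * (1 + 3 * y) = y := by
    intro r
    by_cases h : 1 - 3 * r ^ 2 * (1 + r) = 0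
    · rw [h, div_zero]
      exact ⟨fun h' => absurd h' hy.ne, fun h' => by nlinarith⟩
    · rw [div_eq_iff h]
      constructor <;> intro h' <;> linarith
  have hc : ContinuousOn (fun r : ℝ => r ^ 2 * (1 + r) * (1 + 3 * y)) (Set.Icc 0 1) := by fun_prop
  obtain ⟨r, hr, hre⟩ := intermediate_value_Icc zero_le_one hc
    (show y ∈ Set.Icc _ _ by constructor <;> norm_num <;> linarith)
  have hre : r ^ 2 * (1 + r) * (1 + 3 * y) = y := hre
  have hr0 : 0 < r := by
    rcases hr.1.lt_or_eq with h | h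
    · exact h
    · subst h; norm_num at hre; linarith
  refine ⟨r, ⟨hr0, (key r).2 hre⟩, ?_⟩
  rintro s ⟨hs0, hs⟩
  have hs := (key s).1 hs
  have h : s ^ 2 * (1 + s) = r ^ 2 * (1 + r) :=
    mul_right_cancel₀ (by positivity : (1 + 3 * y) ≠ 0) (hs.trans hre.symm)
  have h2 : (s - r) * (s + r + s ^ 2 + s * r + r ^ 2) = 0 := by linear_combination h
  rcases mul_eq_zero.1 h2 with h3 | h3
  · linarith
  · exact absurd h3 (by positivity)

theorem existsUnique_rhoLow :
    ∃! r : ℝ, 0 < r ∧ r * (1 + r) = 1 - 3 * r ^ 2 * (1 + r) := by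
  have hc : ContinuousOn (fun r : ℝ => r * (1 + r) + 3 * r ^ 2 * (1 + r)) (Set.Icc 0 1) := by
    fun_prop
  obtain ⟨r, hr, hre⟩ := intermediate_value_Icc zero_le_one hc
    (show (1 : ℝ) ∈ Set.Icc _ _ by constructor <;> norm_num)
  have hre : r * (1 + r) + 3 * r ^ 2 * (1 + r) = 1 := hre
  have hr0 : 0 < r := by
    rcases hr.1.lt_or_eq with h | h
    · exact h
    · subst h; norm_num at hre
  refine ⟨r, ⟨hr0, by linarith⟩, ?_⟩
  rintro s ⟨hs0, hs⟩
  have h2 : (s - r) * (1 + 4 * (s + r) + 3 * (s ^ 2 + s * r + r ^ 2)) = 0 := by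
    linear_combination hs - hre
  rcases mul_eq_zero.1 h2 with h3 | h3
  · linarith
  · exact absurd h3 (by positivity)

theorem existsUnique_quad {y : ℝ} (hy : 0 < y) :
    ∃! r : ℝ, 0 < r ∧ (-r ^ 2 + 4 * r + 2) / (r ^ 2 - 3 * r - 1) = y := by
  have key : ∀ r : ℝ, 0 < r → ((-r ^ 2 + 4 * r + 2) / (r ^ 2 - 3 * r - 1) = y ↔
      (1 + y) * r ^ 2 - (4 + 3 * y) * r - (2 + y) = 0) := by
    intro r hr
    by_cases h : r ^ 2 - 3 * r - 1 = 0
    · rw [h, div_zero]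
      refine ⟨fun h' => absurd h' hy.ne, fun h' => ?_⟩
      have : r = -1 := by linear_combination (1 + y) * h - h'
      linarith
    · rw [div_eq_iff h]
      constructor <;> intro h' <;> linarith
  have hc : ContinuousOn (fun r : ℝ => (1 + y) * r ^ 2 - (4 + 3 * y) * r - (2 + y))
      (Set.Icc 0 5) := by fun_prop
  obtain ⟨r, hr, hre⟩ := intermediate_value_Icc (by norm_num : (0 : ℝ) ≤ 5) hc
    (show (0 : ℝ) ∈ Set.Icc _ _ by constructor <;> norm_num <;> linarith)
  have hre : (1 + y) * r ^ 2 - (4 + 3 * y) * r - (2 + y) = 0 := hre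
  have hr0 : 0 < r := by
    rcases hr.1.lt_or_eq with h | h
    · exact h
    · subst h; norm_num at hre; linarith
  refine ⟨r, ⟨hr0, (key r hr0).2 hre⟩, ?_⟩
  rintro s ⟨hs0, hs⟩
  have hs := (key s hs0).1 hs
  have h2 : (s - r) * ((1 + y) * s * r + (2 + y)) = 0 := by
    linear_combination r * hs - s * hre
  rcases mul_eq_zero.1 h2 with h3 | h3
  · linarith
  · exact absurd h3 (by positivity)

/-- `ρ_R = (3 + √17) / 2`. -/
def rhoR : ℝ := (3 + Real.sqrt 17) / 2

theorem rhoR_pos : 0 < rhoR := by unfold rhoR; positivity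

/-- `ρ_L ≈ 0.457332766746115`, the positive root of `ρ²(1+ρ) / (1 - 3ρ²(1+ρ)) = ρ_R`. -/
def rhoL : ℝ := (existsUnique_cubic rhoR_pos).choose

/-- `ρ_* ≈ 0.356341`, the positive root of `ρ(1+ρ) = 1 - 3ρ²(1+ρ)`. -/
def rhoLow : ℝ := existsUnique_rhoLow.choose

/-- `ρ^* ≈ 4.155358`. -/
def rhoUp : ℝ :=
  1 / 2 * ((4 + 3 * rhoLow) / (1 + rhoLow)
    + Real.sqrt (((4 + 3 * rhoLow) / (1 + rhoLow)) ^ 2 + 4 * ((2 + rhoLow) / (1 + rhoLow))))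

theorem rhoUp_pos : 0 < rhoUp := by
  have h : 0 < rhoLow := existsUnique_rhoLow.choose_spec.1.1
  unfold rhoUp
  positivity

/-- `ξ_1 ≈ 0.459770`, the positive root of `ρ²(1+ρ) / (1 - 3ρ²(1+ρ)) = ρ^*`. -/
def xi1 : ℝ := (existsUnique_cubic rhoUp_pos).choose

/-- `ξ_2 ≈ 3.532016`, the positive root of `(-ρ²+4ρ+2) / (ρ²-3ρ-1) = ρ^*`. -/
def xi2 : ℝ := (existsUnique_quad rhoUp_pos).choose

/-- The numerical value of `ρ_L`. -/
theorem rhoL_approx : |rhoL - 0.457332766746115| < 1 / 10 ^ 15 := by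
  obtain ⟨h0, h⟩ := (existsUnique_cubic rhoR_pos).choose_spec.1
  change 0 < rhoL at h0
  change rhoL ^ 2 * (1 + rhoL) / (1 - 3 * rhoL ^ 2 * (1 + rhoL)) = rhoR at h
  have hR := rhoR_pos
  have hd : 1 - 3 * rhoL ^ 2 * (1 + rhoL) ≠ 0 := by
    intro h'; rw [h', div_zero] at h; exact hR.ne h
  rw [div_eq_iff hd] at h
  have h' : rhoL ^ 2 * (1 + rhoL) * (1 + 3 * rhoR) = rhoR := by linarith
  have hl : 3.56155281280883027 < rhoR := by
    have : (4.12310562561766054 : ℝ) < Real.sqrt 17 := by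
      apply Real.lt_sqrt_of_sq_lt; norm_num
    unfold rhoR; linarith
  have hu : rhoR < 3.56155281280883028 := by
    have : Real.sqrt 17 < (4.12310562561766056 : ℝ) := by
      rw [Real.sqrt_lt' (by norm_num)]; norm_num
    unfold rhoR; linarith
  have hmono : ∀ a b : ℝ, 0 ≤ a → a ≤ b → a ^ 2 * (1 + a) ≤ b ^ 2 * (1 + b) := by
    intro a b ha hab
    have hb := ha.trans hab
    gcongr
  rw [abs_lt]
  constructor
  · by_contra hcon
    have h1 := hmono rhoL 0.457332766746114 h0.le (by norm_num at hcon ⊢; linarith)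
    have h2 : rhoR ≤ (0.457332766746114 : ℝ) ^ 2 * (1 + 0.457332766746114) * (1 + 3 * rhoR) := by
      rw [← h']
      nth_rewrite 2 [h']
      gcongr
    norm_num at h2
    linarith
  · by_contra hcon
    have h1 := hmono 0.457332766746116 rhoL (by norm_num) (by norm_num at hcon ⊢; linarith)
    have h2 : (0.457332766746116 : ℝ) ^ 2 * (1 + 0.457332766746116) * (1 + 3 * rhoR) ≤ rhoR := by
      rw [← h']
      nth_rewrite 1 [h']
      gcongr
    norm_num at h2
    linarith

/-! ### The constraints on the step ratios -/

/-- The constraint on `ρ_2` and `ρ_3`. -/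
def InitialConstraint (t : ℕ → ℝ) : Prop :=
  rhoLow < rho t 2 ∧ rhoLow < rho t 3 ∧ rho t 3 < rhoUp ∧
    0 ≤ 2 + 2 / (1 + rho t 3) + 4 * rho t 2 / (1 + rho t 2)
      - rho t 2 ^ 3 / (1 + rho t 2) ^ 2

/-- The constraint on `ρ_k` and `ρ_{k+1}`; it includes `ρ_* < ρ_k < ρ^*`, so that exactly one of
the three cases applies. -/
def StepConstraint (t : ℕ → ℝ) (k : ℕ) : Prop :=
  (rhoLow < rho t k ∧ rho t k < xi1 ∧ rhoLow < rho t (k + 1) ∧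
      rho t (k + 1) ≤ rho t k ^ 2 * (1 + rho t k) / (1 - 3 * rho t k ^ 2 * (1 + rho t k))) ∨
    (xi1 ≤ rho t k ∧ rho t k ≤ xi2 ∧ rhoLow < rho t (k + 1) ∧ rho t (k + 1) < rhoUp) ∨
    (xi2 < rho t k ∧ rho t k < rhoUp ∧ rhoLow < rho t (k + 1) ∧
      rho t (k + 1) ≤ (-rho t k ^ 2 + 4 * rho t k + 2) / (rho t k ^ 2 - 3 * rho t k - 1))

end L2Frac

end

/-! Write w_p for the increment with index p + 1. Up to the factor Γ(1-α), row k ≥ 2 of the form is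
w_{k-1} times Σ d_p^k w_{p-1} (1 ≤ p ≤ k-1), corrected by -a_k^k on w_{k-2} and by c_{k-1}^k + c_k^k
on w_{k-1}. Abel summation (`two_mul_mul_sum`) turns twice the product of w_{k-1} with that sum into
squares of partial sums ending at w_{k-1}, minus squares of partial sums ending at w_{k-2}, both
weighted by d_{p+1}^k - d_p^k, minus d_{k-1}^k w_{k-1}^2. If these weights are nonnegative and do
not increase with k, the positive squares of row k absorb the negative squares of row k + 1, except
the newest one, which involves a single increment. Only diagonal terms and the products with a_k^k
remain. For k ≥ 3 such a product is split by 2xy ≤ x^2 + y^2; for k = 2 it is kept, which produces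
the matrix C and its smaller eigenvalue (`gamma_mul_sum_fracL2_ge`).

Both monotonicities are one statement, `kerD_succ_sub_nonneg`, about any kernel K with K'
nonnegative and nondecreasing: it is applied to (t_k - s)^(-α) and to the difference of two
consecutive such kernels. Integration by parts expresses the coefficients through the moments
`bump`, and the inequality reduces to 1/(ρ_j^2 (1 + ρ_j)) ≤ 1/ρ_{j+1} + 3. The worst case on [ρ_L,
ρ_R] is ρ_j = ρ_L, ρ_{j+1} = ρ_R, where the definition of ρ_L makes it an equality.

The diagonal that remains is bounded below by g_k in `le_diag_mid` and `le_diag_last`. For 3 ≤ k < n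
the positivity of g_k splits into one bound for ρ_{k+1} and one for ρ_k; the second is an equality
exactly at ρ_R. For k ≤ 2 it amounts to C being positive definite. All this is pointwise in space
and is then integrated. The listed constraints on consecutive ratios are a separate elementary
verification. -/

noncomputable section

namespace L2Frac

/-! ### Kernels with nondecreasing derivative and their moments -/

/-- `K` is differentiable on `[a, b]` with a continuous, nondecreasing, nonnegative derivative. -/
structure ConvexKernel (K K' : ℝ → ℝ) (a b : ℝ) : Prop where
  hasDeriv : ∀ s ∈ Set.Icc a b, HasDerivAt K (K' s) s
  cont : ContinuousOn K' (Set.Icc a b)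
  mono : MonotoneOn K' (Set.Icc a b)
  nonneg : ∀ s ∈ Set.Icc a b, 0 ≤ K' s

namespace ConvexKernel

variable {K K' : ℝ → ℝ} {a b : ℝ}

theorem subset (h : ConvexKernel K K' a b) {c d : ℝ} (hc : a ≤ c) (hd : d ≤ b) :
    ConvexKernel K K' c d := by
  have hs : Set.Icc c d ⊆ Set.Icc a b := Set.Icc_subset_Icc hc hd
  exact ⟨fun s hs' => h.hasDeriv s (hs hs'), h.cont.mono hs, h.mono.mono hs,
    fun s hs' => h.nonneg s (hs hs')⟩

theorem continuousOn (h : ConvexKernel K K' a b) : ContinuousOn K (Set.Icc a b) :=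
  fun s hs => (h.hasDeriv s hs).continuousAt.continuousWithinAt

end ConvexKernel

/-- The moment `∫ (s - a) (b - s) K'(s) ds`. -/
def bump (K' : ℝ → ℝ) (a b : ℝ) : ℝ := ∫ s in a..b, (s - a) * (b - s) * K' s

namespace ConvexKernel

variable {K K' : ℝ → ℝ} {a b : ℝ}

theorem intervalIntegrable_mul (h : ConvexKernel K K' a b) (hab : a ≤ b) {w : ℝ → ℝ}
    (hw : Continuous w) : IntervalIntegrable (fun s => w s * K s) volume a b := by
  apply ContinuousOn.intervalIntegrable
  rw [Set.uIcc_of_le hab]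
  exact hw.continuousOn.mul h.continuousOn

theorem intervalIntegrable_mul_deriv (h : ConvexKernel K K' a b) (hab : a ≤ b) {w : ℝ → ℝ}
    (hw : Continuous w) : IntervalIntegrable (fun s => w s * K' s) volume a b := by
  apply ContinuousOn.intervalIntegrable
  rw [Set.uIcc_of_le hab]
  exact hw.continuousOn.mul h.cont

/-- Integration by parts against a weight `W` with derivative `w`. -/
theorem integral_by_parts (h : ConvexKernel K K' a b) (hab : a ≤ b) {W w : ℝ → ℝ}
    (hW : ∀ s, HasDerivAt W (w s) s) (hw : Continuous w) :
    ∫ s in a..b, w s * K s = W b * K b - W a * K a - ∫ s in a..b, W s * K' s := by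
  have hWc : Continuous W := continuous_iff_continuousAt.2 fun s => (hW s).continuousAt
  have i1 := h.intervalIntegrable_mul hab hw
  have i2 := h.intervalIntegrable_mul_deriv hab hWc
  have := intervalIntegral.integral_eq_sub_of_hasDerivAt
    (f := fun s => W s * K s) (f' := fun s => w s * K s + W s * K' s) (a := a) (b := b)
    (fun s hs => by
      rw [Set.uIcc_of_le hab] at hs
      exact (hW s).mul (h.hasDeriv s hs)) (i1.add i2)
  rw [intervalIntegral.integral_add i1 i2] at this
  linarith

theorem integral_centered (h : ConvexKernel K K' a b) (hab : a ≤ b) :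
    ∫ s in a..b, (2 * s - a - b) * K s = bump K' a b := by
  rw [h.integral_by_parts hab (W := fun s => (s - a) * (s - b)) (w := fun s => 2 * s - a - b)
    (fun s => (((hasDerivAt_id s).sub_const a).mul ((hasDerivAt_id s).sub_const b)).congr_deriv
      (by simp only [id]; ring)) (by fun_prop), bump]
  rw [show (fun s => (s - a) * (b - s) * K' s) = fun s => -((s - a) * (s - b) * K' s) by
    ext s; ring, intervalIntegral.integral_neg]
  simp

theorem integral_eq_right (h : ConvexKernel K K' a b) (hab : a ≤ b) :
    ∫ s in a..b, K s = (b - a) * K b - ∫ s in a..b, (s - a) * K' s := by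
  have := h.integral_by_parts hab (W := fun s => s - a) (w := fun _ => 1)
    (fun s => (hasDerivAt_id s).sub_const a) (by fun_prop)
  simpa using this

theorem integral_eq_left (h : ConvexKernel K K' a b) (hab : a ≤ b) :
    ∫ s in a..b, K s = (b - a) * K a + ∫ s in a..b, (b - s) * K' s := by
  have := h.integral_by_parts hab (W := fun s => s - b) (w := fun _ => 1)
    (fun s => (hasDerivAt_id s).sub_const b) (by fun_prop)
  rw [show (fun s => (b - s) * K' s) = fun s => -((s - b) * K' s) by ext s; ring,
    intervalIntegral.integral_neg]
  simp only [one_mul] at this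
  linarith

/-- After integration by parts the right side is (b - a) ∫ (b - s) K', so the bound s - a ≤ b - a
suffices. -/
theorem bump_le_left (h : ConvexKernel K K' a b) (hab : a ≤ b) :
    bump K' a b ≤ (b - a) * ((∫ s in a..b, K s) - (b - a) * K a) := by
  rw [h.integral_eq_left hab, bump, add_sub_cancel_left, ← intervalIntegral.integral_const_mul]
  apply intervalIntegral.integral_mono_on hab
    (h.intervalIntegrable_mul_deriv hab (w := fun s => (s - a) * (b - s)) (by fun_prop))
    ((h.intervalIntegrable_mul_deriv hab (w := fun s => b - s) (by fun_prop)).const_mul _)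
  intro s hs
  have := h.nonneg s hs
  rw [mul_assoc]
  have h2 := hs.1; have h3 := hs.2
  gcongr

/-- A Chebyshev argument: the difference of the sides is the integral of K' against 3 (s - a)(s -
m), a weight of mean zero that changes sign once, from negative to positive, while K' is
nondecreasing. Constant K' gives equality, so 3 is sharp; it is the 3 in `RatioCondition` and in the
equation for ρ_L. -/
theorem three_bump_le_right (h : ConvexKernel K K' a b) (hab : a ≤ b) :
    3 * bump K' a b ≤ (b - a) * ((b - a) * K b - ∫ s in a..b, K s) := by
  rw [h.integral_eq_right hab, bump, sub_sub_cancel, ← intervalIntegral.integral_const_mul,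
    ← intervalIntegral.integral_const_mul, ← sub_nonneg]
  have i1 := (h.intervalIntegrable_mul_deriv hab (w := fun s => s - a) (by fun_prop)).const_mul
    (b - a)
  have i2 := (h.intervalIntegrable_mul_deriv hab (w := fun s => (s - a) * (b - s))
    (by fun_prop)).const_mul 3
  rw [← intervalIntegral.integral_sub i1 i2]
  -- The zero of (b - a) - 3 (b - s), that is m = (a + 2b)/3.
  set m := b - (b - a) / 3 with hm
  have hmem : m ∈ Set.Icc a b := by constructor <;> linarith
  have h0 : ∫ s in a..b, 3 * ((s - a) * (s - m)) * K' m = 0 := by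
    rw [intervalIntegral.integral_mul_const]
    have : ∫ s in a..b, 3 * ((s - a) * (s - m)) = 0 := by
      rw [intervalIntegral.integral_eq_sub_of_hasDerivAt
        (f := fun s => (s - a) ^ 3 - (b - a) * (s - a) ^ 2)
        (f' := fun s => 3 * ((s - a) * (s - m)))]
      · ring
      · intro s _
        have h1 := (hasDerivAt_id s).sub_const a
        refine ((h1.pow 3).sub ((h1.pow 2).const_mul (b - a))).congr_deriv ?_
        simp only [id, hm]; norm_num; ring
      · apply Continuous.intervalIntegrable; fun_prop
    rw [this, zero_mul]
  rw [← h0]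
  apply intervalIntegral.integral_mono_on hab _ (i1.sub i2)
  · intro s hs
    have e : (b - a) * ((s - a) * K' s) - 3 * ((s - a) * (b - s) * K' s)
        = 3 * ((s - a) * (s - m)) * K' s := by rw [hm]; ring
    rw [e, ← sub_nonneg, show 3 * ((s - a) * (s - m)) * K' s - 3 * ((s - a) * (s - m)) * K' m
      = 3 * (s - a) * ((s - m) * (K' s - K' m)) by ring]
    apply mul_nonneg (by linarith [hs.1])
    rcases le_total s m with hsm | hsm
    · exact mul_nonneg_of_nonpos_of_nonpos (by linarith) (by linarith [h.mono hs hmem hsm])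
    · exact mul_nonneg (by linarith) (by linarith [h.mono hmem hs hsm])
  · apply Continuous.intervalIntegrable; fun_prop

theorem integral_bump_weight (a b : ℝ) : ∫ s in a..b, (s - a) * (b - s) = (b - a) ^ 3 / 6 := by
  rw [intervalIntegral.integral_eq_sub_of_hasDerivAt
    (f := fun s => (b - a) / 2 * (s - a) ^ 2 - (s - a) ^ 3 / 3)
    (f' := fun s => (s - a) * (b - s))]
  · ring
  · intro s _
    have h1 := (hasDerivAt_id s).sub_const a
    refine (((h1.pow 2).const_mul ((b - a) / 2)).sub ((h1.pow 3).div_const 3)).congr_deriv ?_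
    simp only [id]; norm_num; ring
  · apply Continuous.intervalIntegrable; fun_prop

theorem bump_le (h : ConvexKernel K K' a b) (hab : a ≤ b) :
    bump K' a b ≤ (b - a) ^ 3 / 6 * K' b := by
  rw [← integral_bump_weight, ← intervalIntegral.integral_mul_const, bump]
  apply intervalIntegral.integral_mono_on hab
    (h.intervalIntegrable_mul_deriv hab (w := fun s => (s - a) * (b - s)) (by fun_prop))
    (Continuous.intervalIntegrable (by fun_prop) _ _)
  intro s hs
  exact mul_le_mul_of_nonneg_left (h.mono hs (Set.right_mem_Icc.2 hab) hs.2)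
    (mul_nonneg (by linarith [hs.1]) (by linarith [hs.2]))

theorem le_bump (h : ConvexKernel K K' a b) (hab : a ≤ b) :
    (b - a) ^ 3 / 6 * K' a ≤ bump K' a b := by
  rw [← integral_bump_weight, ← intervalIntegral.integral_mul_const, bump]
  apply intervalIntegral.integral_mono_on hab
    (Continuous.intervalIntegrable (by fun_prop) _ _)
    (h.intervalIntegrable_mul_deriv hab (w := fun s => (s - a) * (b - s)) (by fun_prop))
  intro s hs
  exact mul_le_mul_of_nonneg_left (h.mono (Set.left_mem_Icc.2 hab) hs hs.1)
    (mul_nonneg (by linarith [hs.1]) (by linarith [hs.2]))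

theorem bump_nonneg (h : ConvexKernel K K' a b) (hab : a ≤ b) : 0 ≤ bump K' a b := by
  refine le_trans ?_ (h.le_bump hab)
  have := h.nonneg a (Set.left_mem_Icc.2 hab)
  have : 0 ≤ b - a := by linarith
  positivity

end ConvexKernel

/-! ### The power kernel -/

theorem hasDerivAt_rpow_sub {c s : ℝ} (h : s < c) (r : ℝ) :
    HasDerivAt (fun s : ℝ => (c - s) ^ r) (-r * (c - s) ^ (r - 1)) s := by
  have := ((hasDerivAt_id s).const_sub c).rpow_const (p := r) (Or.inl (by simp; linarith))
  exact this.congr_deriv (by simp)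

theorem hasDerivAt_ker {c s α : ℝ} (h : s < c) :
    HasDerivAt (fun s : ℝ => 1 / (c - s) ^ α) (α * (c - s) ^ (-α - 1)) s := by
  have := hasDerivAt_rpow_sub h (-α)
  rw [neg_neg] at this
  apply this.congr_of_eventuallyEq
  filter_upwards [eventually_lt_nhds h] with x hx
  rw [Real.rpow_neg (by linarith), one_div]

theorem continuousOn_rpow_sub {a b c : ℝ} (hbc : b < c) (r : ℝ) :
    ContinuousOn (fun s : ℝ => (c - s) ^ r) (Set.Icc a b) := fun s hs =>
  (hasDerivAt_rpow_sub (by linarith [hs.2]) r).continuousAt.continuousWithinAt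

theorem convexKernel_ker {a b c α : ℝ} (hα : 0 < α) (hbc : b < c) :
    ConvexKernel (fun s => 1 / (c - s) ^ α) (fun s => α * (c - s) ^ (-α - 1)) a b where
  hasDeriv s hs := hasDerivAt_ker (by linarith [hs.2])
  cont := (continuousOn_rpow_sub hbc _).const_smul α
  mono x hx y hy hxy := by
    apply mul_le_mul_of_nonneg_left _ hα.le
    exact Real.rpow_le_rpow_of_nonpos (by linarith [hy.2]) (by linarith) (by linarith)
  nonneg s hs := mul_nonneg hα.le (Real.rpow_nonneg (by linarith [hs.2]) _)

/-- The first two derivatives of (c - s)^(-α) in s are positive multiples of (c - s)^(-α-1) and (c -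
s)^(-α-2), which decrease as c grows. Hence the difference of two such kernels again has a
nonnegative, nondecreasing derivative. -/
theorem convexKernel_ker_sub {a b c c' α : ℝ} (hα : 0 < α) (hbc : b < c) (hc : c ≤ c') :
    ConvexKernel (fun s => 1 / (c - s) ^ α - 1 / (c' - s) ^ α)
      (fun s => α * (c - s) ^ (-α - 1) - α * (c' - s) ^ (-α - 1)) a b where
  hasDeriv s hs := (hasDerivAt_ker (by linarith [hs.2])).sub (hasDerivAt_ker (by linarith [hs.2]))
  cont := (convexKernel_ker hα hbc).cont.sub (convexKernel_ker hα (hbc.trans_le hc)).cont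
  mono := by
    have hd : ∀ s ∈ Set.Icc a b,
        HasDerivAt (fun s => α * (c - s) ^ (-α - 1) - α * (c' - s) ^ (-α - 1))
          (α * (-(-α - 1) * (c - s) ^ (-α - 1 - 1)) - α * (-(-α - 1) * (c' - s) ^ (-α - 1 - 1)))
          s := fun s hs =>
      ((hasDerivAt_rpow_sub (by linarith [hs.2]) _).const_mul α).sub
        ((hasDerivAt_rpow_sub (by linarith [hs.2]) _).const_mul α)
    apply monotoneOn_of_deriv_nonneg (convex_Icc a b)
    · exact fun s hs => (hd s hs).continuousAt.continuousWithinAt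
    · exact fun s hs => (hd s (interior_subset hs)).differentiableAt.differentiableWithinAt
    · intro s hs
      have hs' := interior_subset hs
      rw [(hd s hs').deriv, sub_nonneg]
      have h1 := hs'.2
      have := Real.rpow_le_rpow_of_nonpos (x := c - s) (y := c' - s) (z := -α - 1 - 1)
        (by linarith) (by linarith) (by linarith)
      have h2 : 0 ≤ -(-α - 1) := by linarith
      gcongr
  nonneg s hs := by
    rw [sub_nonneg]
    apply mul_le_mul_of_nonneg_left _ hα.le
    exact Real.rpow_le_rpow_of_nonpos (by linarith [hs.2]) (by linarith) (by linarith)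

theorem integral_rpow_sub {a b c r : ℝ} (hr : -1 < r) :
    ∫ s in a..b, (c - s) ^ r = ((c - a) ^ (r + 1) - (c - b) ^ (r + 1)) / (r + 1) := by
  rw [intervalIntegral.integral_comp_sub_left (fun x => x ^ r) c, integral_rpow (Or.inl hr)]

theorem intervalIntegrable_ker {a b c α : ℝ} (hα : α < 1) (hab : a ≤ b) (hbc : b ≤ c)
    {w : ℝ → ℝ} (hw : Continuous w) :
    IntervalIntegrable (fun s => w s * (1 / (c - s) ^ α)) volume a b := by
  have h1 : IntervalIntegrable (fun s => (c - s) ^ (-α)) volume a b := by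
    have := (intervalIntegral.intervalIntegrable_rpow' (a := c - a) (b := c - b)
      (r := -α) (by linarith)).comp_sub_left c
    simpa using this
  have h2 := h1.continuousOn_mul (g := w) hw.continuousOn
  apply h2.congr
  intro s hs
  rw [Set.uIoc_of_le hab] at hs
  simp only
  rw [Real.rpow_neg (by linarith [hs.2]), one_div]

theorem integral_affine_ker {a b c α : ℝ} (hα : α < 1) (hab : a ≤ b) (hbc : b ≤ c) (p q : ℝ) :
    ∫ s in a..b, (p + q * (c - s)) * (1 / (c - s) ^ α)
      = p * (((c - a) ^ (1 - α) - (c - b) ^ (1 - α)) / (1 - α))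
        + q * (((c - a) ^ (2 - α) - (c - b) ^ (2 - α)) / (2 - α)) := by
  have e : ∫ s in a..b, (p + q * (c - s)) * (1 / (c - s) ^ α)
      = ∫ s in a..b, (p * (c - s) ^ (-α) + q * (c - s) ^ (1 - α)) := by
    apply intervalIntegral.integral_congr
    intro s hs
    rw [Set.uIcc_of_le hab] at hs
    have h0 : 0 ≤ c - s := by linarith [hs.2]
    simp only
    rw [Real.rpow_neg h0, one_div]
    rcases h0.eq_or_lt with h | h
    -- At s = c the two integrands also agree: the factor c - s vanishes on one side and 0 ^ (1 - α)
    -- = 0 on the other.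
    · rw [← h, Real.zero_rpow (by linarith : 1 - α ≠ 0)]; ring
    · rw [Real.rpow_sub h, Real.rpow_one]; ring
  have i1 : ∀ r : ℝ, -1 < r → IntervalIntegrable (fun s => (c - s) ^ r) volume a b := by
    intro r hr
    simpa using (intervalIntegral.intervalIntegrable_rpow' (a := c - a) (b := c - b)
      hr).comp_sub_left c
  rw [e, intervalIntegral.integral_add ((i1 _ (by linarith)).const_mul p)
    ((i1 _ (by linarith)).const_mul q), intervalIntegral.integral_const_mul,
    intervalIntegral.integral_const_mul, integral_rpow_sub (by linarith),
    integral_rpow_sub (by linarith)]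
  ring_nf

/-! ### Coefficients of a general kernel -/

/-- The coefficient `a_j` with the kernel `(t_k - s)^(-α)` replaced by `K`. -/
def kerA (t : ℕ → ℝ) (K : ℝ → ℝ) (j : ℕ) : ℝ :=
  ∫ s in (t (j - 1))..(t j),
    (2 * s - t j - t (j + 1)) / (tau t j * (tau t j + tau t (j + 1))) * K s

/-- The coefficient `c_j` with the kernel `(t_k - s)^(-α)` replaced by `K`. -/
def kerC (t : ℕ → ℝ) (K : ℝ → ℝ) (j : ℕ) : ℝ :=
  ∫ s in (t (j - 1))..(t j),
    (2 * s - t (j - 1) - t j) / (tau t (j + 1) * (tau t j + tau t (j + 1))) * K s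

/-- The coefficient of the `j`-th increment: `0`, `-a_1`, and `d_j = c_{j-1} - a_j` for `j ≥ 2`. -/
def kerD (t : ℕ → ℝ) (K : ℝ → ℝ) : ℕ → ℝ
  | 0 => 0
  | 1 => -kerA t K 1
  | j + 2 => kerC t K (j + 1) - kerA t K (j + 2)

theorem tau_pos {t : ℕ → ℝ} (ht : StrictMono t) {k : ℕ} (hk : 1 ≤ k) : 0 < tau t k :=
  sub_pos.2 (ht (by omega))

theorem rho_pos {t : ℕ → ℝ} (ht : StrictMono t) {k : ℕ} (hk : 2 ≤ k) : 0 < rho t k :=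
  div_pos (tau_pos ht (by omega)) (tau_pos ht (by omega))

section

variable {t : ℕ → ℝ} {K K' : ℝ → ℝ} {j : ℕ}

theorem kerC_eq (ht : StrictMono t) (h : ConvexKernel K K' (t j) (t (j + 1))) :
    kerC t K (j + 1) = bump K' (t j) (t (j + 1)) /
      (tau t (j + 2) * (tau t (j + 1) + tau t (j + 2))) := by
  rw [← h.integral_centered (ht.monotone j.le_succ), ← intervalIntegral.integral_div, kerC]
  simp only [Nat.add_sub_cancel]
  congr 1
  ext s
  ring

theorem kerA_eq (ht : StrictMono t) (h : ConvexKernel K K' (t j) (t (j + 1))) :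
    kerA t K (j + 1) = bump K' (t j) (t (j + 1)) /
      (tau t (j + 1) * (tau t (j + 1) + tau t (j + 2)))
      - (∫ s in (t j)..(t (j + 1)), K s) / tau t (j + 1) := by
  have hj := ht.monotone j.le_succ
  have h1 := tau_pos ht (k := j + 1) (by omega)
  have h2 := tau_pos ht (k := j + 2) (by omega)
  rw [← h.integral_centered hj, ← intervalIntegral.integral_div, ← intervalIntegral.integral_div,
    ← intervalIntegral.integral_sub
      ((h.intervalIntegrable_mul hj (w := fun s => 2 * s - t j - t (j + 1)) (by fun_prop)).div_const
        _)
      (IntervalIntegrable.div_const (by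
        simpa using h.intervalIntegrable_mul hj (w := fun _ => 1) (by fun_prop)) _), kerA]
  simp only [Nat.add_sub_cancel]
  congr 1
  ext s
  field_simp
  simp only [tau]
  norm_num
  ring

theorem kerC_nonneg (ht : StrictMono t) (h : ConvexKernel K K' (t j) (t (j + 1))) :
    0 ≤ kerC t K (j + 1) := by
  rw [kerC_eq ht h]
  have h1 := tau_pos ht (k := j + 1) (by omega)
  have h2 := tau_pos ht (k := j + 2) (by omega)
  have := h.bump_nonneg (ht.monotone j.le_succ)
  positivity

/-- By `kerA_eq`, -a_{j+1} is the mean of K minus a nonnegative moment term. Enlarging that term to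
bump / τ^2 and using `bump_le_left` still leaves at least the left endpoint value. With
`neg_le_kerA`, the number -a_{j+1} lies between the endpoint values of K, which lets neighbouring
intervals be compared at their common node. -/
theorem kerA_le (ht : StrictMono t) (h : ConvexKernel K K' (t j) (t (j + 1))) :
    kerA t K (j + 1) ≤ -K (t j) := by
  have h1 := tau_pos ht (k := j + 1) (by omega)
  have h2 := tau_pos ht (k := j + 2) (by omega)
  have hj := ht.monotone j.le_succ
  have hb := h.bump_nonneg hj
  have hl := h.bump_le_left hj
  have e : t (j + 1) - t j = tau t (j + 1) := by simp [tau]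
  rw [e] at hl
  have hB : bump K' (t j) (t (j + 1)) / (tau t (j + 1) * (tau t (j + 1) + tau t (j + 2)))
      ≤ bump K' (t j) (t (j + 1)) / (tau t (j + 1) * tau t (j + 1)) := by
    gcongr; linarith
  have hB2 : bump K' (t j) (t (j + 1)) / (tau t (j + 1) * tau t (j + 1))
      ≤ (∫ s in (t j)..(t (j + 1)), K s) / tau t (j + 1) - K (t j) := by
    rw [div_le_iff₀ (by positivity)]
    calc _ ≤ _ := hl
      _ = _ := by field_simp
  rw [kerA_eq ht h]
  linarith

theorem neg_le_kerA (ht : StrictMono t) (h : ConvexKernel K K' (t j) (t (j + 1))) :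
    -K (t (j + 1)) ≤ kerA t K (j + 1) := by
  have h1 := tau_pos ht (k := j + 1) (by omega)
  have h2 := tau_pos ht (k := j + 2) (by omega)
  have hj := ht.monotone j.le_succ
  have hb := h.bump_nonneg hj
  have hl := h.three_bump_le_right hj
  have e : t (j + 1) - t j = tau t (j + 1) := by simp [tau]
  rw [e] at hl
  have h3 : 0 ≤ tau t (j + 1) * K (t (j + 1)) - ∫ s in (t j)..(t (j + 1)), K s :=
    nonneg_of_mul_nonneg_right (by linarith) h1
  have h4 : (∫ s in (t j)..(t (j + 1)), K s) / tau t (j + 1) ≤ K (t (j + 1)) := by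
    rw [div_le_iff₀ h1]; linarith
  rw [kerA_eq ht h]
  have : 0 ≤ bump K' (t j) (t (j + 1)) / (tau t (j + 1) * (tau t (j + 1) + tau t (j + 2))) := by
    positivity
  linarith

/-! ### Monotonicity of the coefficients d_j -/

/-- The restriction on adjacent step ratios under which the coefficients `d_j` increase. -/
def RatioCondition (t : ℕ → ℝ) (j : ℕ) : Prop :=
  1 / (rho t j ^ 2 * (1 + rho t j)) ≤ 1 / rho t (j + 1) + 3

/-- Let p, q, r be the three steps and B1, B2 the moments over the first two. The two B2 terms on
the right combine to B2/(qr), and `three_bump_le_right` gives 3 B2/q^2 more, in total (B2/q^3) q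
(1/ρ_{j+3} + 3). The left side is (B1/p^3) q / (ρ_{j+2}^2 (1 + ρ_{j+2})). Monotonicity of K' gives
B1/p^3 ≤ B2/q^3, and the ratio condition compares the remaining factors. -/
theorem kerC_le_of_ratioCondition (ht : StrictMono t)
    (h : ConvexKernel K K' (t j) (t (j + 2))) (hr : RatioCondition t (j + 2)) :
    kerC t K (j + 1) ≤ K (t (j + 2)) + kerC t K (j + 2) + kerA t K (j + 2) := by
  have m1 := ht.monotone (Nat.le_succ j)
  have m2 := ht.monotone (Nat.le_succ (j + 1))
  have k1 := h.subset le_rfl m2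
  have k2 := h.subset m1 le_rfl
  have h1 := tau_pos ht (k := j + 1) (by omega)
  have h2 := tau_pos ht (k := j + 2) (by omega)
  have h3 := tau_pos ht (k := j + 3) (by omega)
  rw [kerC_eq ht k1, kerC_eq ht k2, kerA_eq ht k2]
  have e1 : t (j + 1) - t j = tau t (j + 1) := by simp [tau]
  have e2 : t (j + 1 + 1) - t (j + 1) = tau t (j + 2) := by simp [tau]
  have b1 := k1.bump_le m1
  have b2 := k2.le_bump m2
  have b3 := k2.three_bump_le_right m2
  have hB2 : 0 ≤ bump K' (t (j + 1)) (t (j + 2)) := k2.bump_nonneg m2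
  rw [e1] at b1
  rw [e2] at b2 b3
  rw [RatioCondition, rho, rho] at hr
  simp only [show j + 2 + 1 - 1 = j + 2 by omega, show j + 2 - 1 = j + 1 by omega,
    show j + 2 + 1 = j + 3 by omega, show j + 1 + 1 = j + 2 by omega] at *
  generalize tau t (j + 1) = p at *
  generalize tau t (j + 2) = q at *
  generalize tau t (j + 3) = r at *
  generalize bump K' (t j) (t (j + 1)) = B1 at *
  generalize bump K' (t (j + 1)) (t (j + 2)) = B2 at *
  generalize (∫ s in (t (j + 1))..(t (j + 2)), K s) = M at *
  -- Both sides are compared with K'/6 at the common node t_{j+1}.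
  have hB1 : B1 / p ^ 3 ≤ B2 / q ^ 3 := by
    rw [div_le_iff₀ (by positivity)]
    have : K' (t (j + 1)) / 6 ≤ B2 / q ^ 3 := by
      rw [le_div_iff₀ (by positivity)]; linarith
    calc B1 ≤ p ^ 3 / 6 * K' (t (j + 1)) := b1
      _ = K' (t (j + 1)) / 6 * p ^ 3 := by ring
      _ ≤ _ := by gcongr
  have hM : 3 * (B2 / q ^ 2) ≤ K (t (j + 2)) - M / q := by
    rw [← mul_div_assoc, div_le_iff₀ (by positivity)]
    calc _ ≤ _ := b3
      _ = _ := by field_simp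
  have hx : B1 / (q * (p + q)) = B1 / p ^ 3 * (q * (1 / ((q / p) ^ 2 * (1 + q / p)))) := by
    field_simp
  have hy : B2 / (r * (q + r)) + B2 / (q * (q + r)) = B2 / q ^ 3 * (q * (1 / (r / q))) := by
    field_simp
  have hz : B2 / q ^ 2 = B2 / q ^ 3 * q := by field_simp
  have : B1 / (q * (p + q)) ≤ B2 / q ^ 3 * (q * (1 / (r / q) + 3)) := by
    rw [hx]
    gcongr
  have e3 : B2 / q ^ 3 * (q * (1 / (r / q) + 3)) = B2 / q ^ 3 * (q * (1 / (r / q))) +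
    3 * (B2 / q ^ 3 * q) := by ring
  rw [e3, ← hy, ← hz] at this
  linarith

/-- In each case -a_{p+1} is at least K(t_p). For p = 0 this is nonnegative; for p = 1 it dominates
d_1 = -a_1 ≤ K(t_1); for larger p the claim becomes `kerC_le_of_ratioCondition`. -/
theorem kerD_succ_sub_nonneg (ht : StrictMono t) {m : ℕ}
    (h : ConvexKernel K K' (t 0) (t m)) (h0 : 0 ≤ K (t 0))
    (hr : ∀ k, 2 ≤ k → RatioCondition t k) {p : ℕ} (hp : p + 1 ≤ m) :
    0 ≤ kerD t K (p + 1) - kerD t K p := by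
  have sub : ∀ i l, l ≤ m → ConvexKernel K K' (t i) (t l) := fun i l hl =>
    h.subset (ht.monotone (Nat.zero_le i)) (ht.monotone hl)
  match p with
  | 0 =>
    have := kerA_le ht (sub 0 1 (by omega))
    simp only [kerD, zero_add] at this ⊢
    linarith
  | 1 =>
    have h1 := kerA_le ht (sub 1 2 (by omega))
    have h2 := neg_le_kerA ht (sub 0 1 (by omega))
    have h3 := kerC_nonneg ht (sub 0 1 (by omega))
    simp only [kerD, zero_add, Nat.reduceAdd] at h1 h2 h3 ⊢
    linarith
  | p + 2 =>
    have h1 := kerA_le ht (sub (p + 2) (p + 3) (by omega))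
    have h2 := kerC_le_of_ratioCondition ht (sub p (p + 2) (by omega)) (hr _ (by omega))
    simp only [kerD, show p + 2 + 1 = p + 1 + 2 by omega, show p + 1 + 1 = p + 2 by omega] at h1 h2 ⊢
    rw [show p + 1 + 2 = p + 2 + 1 by omega] at *
    linarith

theorem kerA_sub {L : ℝ → ℝ} (ht : StrictMono t) (hK : ContinuousOn K (Set.Icc (t j) (t (j + 1))))
    (hL : ContinuousOn L (Set.Icc (t j) (t (j + 1)))) :
    kerA t (fun s => K s - L s) (j + 1) = kerA t K (j + 1) - kerA t L (j + 1) := by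
  simp only [kerA, Nat.add_sub_cancel, mul_sub]
  apply intervalIntegral.integral_sub <;>
  · apply ContinuousOn.intervalIntegrable
    rw [Set.uIcc_of_le (ht.monotone j.le_succ)]
    exact ContinuousOn.mul (by fun_prop) (by assumption)

theorem kerC_sub {L : ℝ → ℝ} (ht : StrictMono t) (hK : ContinuousOn K (Set.Icc (t j) (t (j + 1))))
    (hL : ContinuousOn L (Set.Icc (t j) (t (j + 1)))) :
    kerC t (fun s => K s - L s) (j + 1) = kerC t K (j + 1) - kerC t L (j + 1) := by
  simp only [kerC, Nat.add_sub_cancel, mul_sub]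
  apply intervalIntegral.integral_sub <;>
  · apply ContinuousOn.intervalIntegrable
    rw [Set.uIcc_of_le (ht.monotone j.le_succ)]
    exact ContinuousOn.mul (by fun_prop) (by assumption)

theorem kerD_sub {L : ℝ → ℝ} (ht : StrictMono t) {m : ℕ}
    (hK : ContinuousOn K (Set.Icc (t 0) (t m))) (hL : ContinuousOn L (Set.Icc (t 0) (t m)))
    {p : ℕ} (hp : p ≤ m) :
    kerD t (fun s => K s - L s) p = kerD t K p - kerD t L p := by
  have sub : ∀ i, i + 1 ≤ m → Set.Icc (t i) (t (i + 1)) ⊆ Set.Icc (t 0) (t m) := fun i hi =>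
    Set.Icc_subset_Icc (ht.monotone (Nat.zero_le i)) (ht.monotone hi)
  match p with
  | 0 => simp [kerD]
  | 1 =>
    have := kerA_sub ht (hK.mono (sub 0 hp)) (hL.mono (sub 0 hp))
    simp only [kerD, zero_add] at this ⊢
    linarith
  | p + 2 =>
    have h1 := kerA_sub ht (hK.mono (sub (p + 1) hp)) (hL.mono (sub (p + 1) hp))
    have h2 := kerC_sub ht (hK.mono (sub p (by omega))) (hL.mono (sub p (by omega)))
    simp only [kerD]
    simp only [show p + 1 + 1 = p + 2 by omega] at h1
    linarith

end

/-! ### The coefficients of the operator -/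

/-- The kernel `(t_k - s)^(-α)`. -/
def ker (α : ℝ) (t : ℕ → ℝ) (k : ℕ) (s : ℝ) : ℝ := 1 / (t k - s) ^ α

section

variable {α : ℝ} {t : ℕ → ℝ}

theorem coefA_of_lt {k j : ℕ} (h : j < k) : coefA α t k j = kerA t (ker α t k) j := by
  simp only [coefA, if_pos h, kerA, ker]

theorem coefC_of_lt {k j : ℕ} (h : j < k) : coefC α t k j = kerC t (ker α t k) j := by
  simp only [coefC, if_pos h, kerC, ker]

theorem integral_affine_ker_of_eq (hα : α < 1) {a b c p q : ℝ} (hab : a ≤ b) (hbc : b ≤ c)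
    {w : ℝ → ℝ} (hw : ∀ s, w s = p + q * (c - s)) :
    ∫ s in a..b, w s * (1 / (c - s) ^ α)
      = p * (((c - a) ^ (1 - α) - (c - b) ^ (1 - α)) / (1 - α))
        + q * (((c - a) ^ (2 - α) - (c - b) ^ (2 - α)) / (2 - α)) := by
  rw [← integral_affine_ker hα hab hbc]
  simp only [hw]

/-! ### Closed forms next to the singularity -/

theorem coefA_self (hα1 : α < 1) (ht : StrictMono t) {k : ℕ} (hk : 2 ≤ k) :
    coefA α t k k = α * (rho t k ^ 2 / (1 + rho t k)) / ((1 - α) * (2 - α) * tau t k ^ α) := by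
  obtain ⟨k, rfl⟩ : ∃ m, k = m + 2 := ⟨k - 2, by omega⟩
  have h1 := tau_pos ht (k := k + 1) (by omega)
  have h2 := tau_pos ht (k := k + 2) (by omega)
  rw [coefA, if_neg (lt_irrefl _), rho]
  simp only [show k + 2 - 1 = k + 1 by omega]
  have e : t (k + 2) - t (k + 1) = tau t (k + 2) := by simp [tau]
  rw [integral_affine_ker_of_eq hα1 (ht.monotone (by omega)) le_rfl
    (p := tau t (k + 2) / (tau t (k + 1) * (tau t (k + 1) + tau t (k + 2))))
    (q := -2 / (tau t (k + 1) * (tau t (k + 1) + tau t (k + 2))))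
    (fun s => by rw [← e]; field_simp; ring), e, sub_self,
    Real.zero_rpow (by linarith), Real.zero_rpow (by linarith), Real.rpow_sub h2,
    Real.rpow_sub h2, Real.rpow_one, Real.rpow_two]
  have := Real.rpow_pos_of_pos h2 α
  have a1 : 1 - α ≠ 0 := by linarith
  have a2 : 2 - α ≠ 0 := by linarith
  field_simp
  ring

theorem coefC_self (hα1 : α < 1) (ht : StrictMono t) {k : ℕ} (hk : 2 ≤ k) :
    coefC α t k k
      = (2 * rho t k + 2 - α) / (1 + rho t k) / ((1 - α) * (2 - α) * tau t k ^ α) := by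
  obtain ⟨k, rfl⟩ : ∃ m, k = m + 2 := ⟨k - 2, by omega⟩
  have h1 := tau_pos ht (k := k + 1) (by omega)
  have h2 := tau_pos ht (k := k + 2) (by omega)
  rw [coefC, if_neg (lt_irrefl _), rho]
  simp only [show k + 2 - 1 = k + 1 by omega, show k + 2 - 2 = k by omega]
  have e : t (k + 2) - t (k + 1) = tau t (k + 2) := by simp [tau]
  have e' : t (k + 1) - t k = tau t (k + 1) := by simp [tau]
  rw [integral_affine_ker_of_eq hα1 (ht.monotone (by omega)) le_rfl
    (p := (2 * tau t (k + 2) + tau t (k + 1)) /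
      (tau t (k + 2) * (tau t (k + 1) + tau t (k + 2))))
    (q := -2 / (tau t (k + 2) * (tau t (k + 1) + tau t (k + 2))))
    (fun s => by rw [← e, ← e']; ring), e, sub_self,
    Real.zero_rpow (by linarith), Real.zero_rpow (by linarith), Real.rpow_sub h2,
    Real.rpow_sub h2, Real.rpow_one, Real.rpow_two]
  have := Real.rpow_pos_of_pos h2 α
  have a1 : 1 - α ≠ 0 := by linarith
  have a2 : 2 - α ≠ 0 := by linarith
  field_simp
  ring

theorem coefA_succ (hα1 : α < 1) (ht : StrictMono t) {k : ℕ} (hk : 1 ≤ k) :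
    coefA α t (k + 1) k
      = ((α * rho t (k + 1) - 2 + 2 * α) / (1 + rho t (k + 1)) ^ α
          - α * rho t (k + 1) ^ (2 - α) / (1 + rho t (k + 1)))
        / ((1 - α) * (2 - α) * tau t k ^ α) := by
  obtain ⟨k, rfl⟩ : ∃ m, k = m + 1 := ⟨k - 1, by omega⟩
  have h1 := tau_pos ht (k := k + 1) (by omega)
  have h2 := tau_pos ht (k := k + 2) (by omega)
  rw [coefA, if_pos (by omega), rho]
  simp only [show k + 1 - 1 = k by omega, show k + 1 + 1 - 1 = k + 1 by omega,
    show k + 1 + 1 = k + 2 by omega]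
  have e : t (k + 2) - t (k + 1) = tau t (k + 2) := by simp [tau]
  have e' : t (k + 1) - t k = tau t (k + 1) := by simp [tau]
  have e3 : t (k + 2) - t k = tau t (k + 1) + tau t (k + 2) := by rw [← e, ← e']; ring
  have h3 : 0 < tau t (k + 1) + tau t (k + 2) := by positivity
  rw [integral_affine_ker_of_eq hα1 (ht.monotone (by omega)) (ht.monotone (by omega))
    (p := tau t (k + 2) / (tau t (k + 1) * (tau t (k + 1) + tau t (k + 2))))
    (q := -2 / (tau t (k + 1) * (tau t (k + 1) + tau t (k + 2))))
    (fun s => by rw [← e]; ring), e, e3,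
    show 1 + tau t (k + 2) / tau t (k + 1) = (tau t (k + 1) + tau t (k + 2)) / tau t (k + 1) by
      field_simp,
    Real.rpow_sub h2, Real.rpow_sub h2, Real.rpow_sub h3, Real.rpow_sub h3,
    Real.rpow_sub (by positivity), Real.rpow_one, Real.rpow_one, Real.rpow_two, Real.rpow_two,
    Real.rpow_two, Real.div_rpow h2.le h1.le, Real.div_rpow h3.le h1.le]
  have := Real.rpow_pos_of_pos h1 α
  have := Real.rpow_pos_of_pos h2 α
  have := Real.rpow_pos_of_pos h3 α
  have a1 : 1 - α ≠ 0 := by linarith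
  have a2 : 2 - α ≠ 0 := by linarith
  generalize tau t (k + 1) ^ α = A at *
  generalize tau t (k + 2) ^ α = B at *
  generalize (tau t (k + 1) + tau t (k + 2)) ^ α = C at *
  field_simp
  ring

/-! ### The operator in terms of increments -/

theorem deriv_quadInterp (ht : StrictMono t) (v : ℕ → ℝ) (j : ℕ) (s : ℝ) :
    deriv (quadInterp t v (j + 1)) s
      = -((2 * s - t (j + 1) - t (j + 2)) / (tau t (j + 1) * (tau t (j + 1) + tau t (j + 2))))
          * (v (j + 1) - v j)
        + (2 * s - t j - t (j + 1)) / (tau t (j + 2) * (tau t (j + 1) + tau t (j + 2)))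
          * (v (j + 2) - v (j + 1)) := by
  have h1 := tau_pos ht (k := j + 1) (by omega)
  have h2 := tau_pos ht (k := j + 2) (by omega)
  have key : ∀ a b : ℝ, HasDerivAt (fun s : ℝ => (s - a) * (s - b)) (2 * s - a - b) s := by
    intro a b
    exact (((hasDerivAt_id s).sub_const a).mul ((hasDerivAt_id s).sub_const b)).congr_deriv
      (by simp only [id]; ring)
  have hd : HasDerivAt (quadInterp t v (j + 1)) _ s :=
    ((((key (t (j + 1)) (t (j + 2))).div_const ((t j - t (j + 1)) * (t j - t (j + 2)))).mul_const
      (v j)).add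
    (((key (t j) (t (j + 2))).div_const ((t (j + 1) - t j) * (t (j + 1) - t (j + 2)))).mul_const
      (v (j + 1)))).add
    (((key (t j) (t (j + 1))).div_const ((t (j + 2) - t j) * (t (j + 2) - t (j + 1)))).mul_const
      (v (j + 2)))
  rw [hd.deriv]
  have e2 : t (j + 2) = t j + tau t (j + 1) + tau t (j + 2) := by simp [tau]
  have e1 : t (j + 1) = t j + tau t (j + 1) := by simp [tau]
  rw [e2, e1]
  generalize tau t (j + 1) = p at *
  generalize tau t (j + 2) = q at *
  generalize t j = x at *
  rw [show x - (x + p) = -p by ring, show x - (x + p + q) = -(p + q) by ring,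
    show x + p - x = p by ring, show x + p - (x + p + q) = -q by ring,
    show x + p + q - x = p + q by ring, show x + p + q - (x + p) = q by ring]
  field_simp
  ring

theorem integral_deriv_quadInterp_of_lt (hα1 : α < 1) (ht : StrictMono t) (v : ℕ → ℝ) {k j : ℕ}
    (hj : 1 ≤ j) (hjk : j < k) :
    ∫ s in (t (j - 1))..(t j), deriv (quadInterp t v j) s / (t k - s) ^ α
      = -coefA α t k j * (v j - v (j - 1)) + coefC α t k j * (v (j + 1) - v j) := by
  obtain ⟨j, rfl⟩ : ∃ m, j = m + 1 := ⟨j - 1, by omega⟩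
  have hm := ht.monotone (j.le_succ)
  have hm' := ht.monotone hjk.le
  rw [coefA, coefC, if_pos hjk, if_pos hjk]
  simp only [show j + 1 - 1 = j by omega, show j + 1 + 1 = j + 2 by omega]
  rw [← intervalIntegral.integral_neg, ← intervalIntegral.integral_mul_const,
    ← intervalIntegral.integral_mul_const, ← intervalIntegral.integral_add]
  · congr 1
    ext s
    rw [deriv_quadInterp ht]
    ring
  · exact (IntervalIntegrable.neg (intervalIntegrable_ker hα1 hm hm' (by fun_prop))).mul_const _
  · exact (intervalIntegrable_ker hα1 hm hm' (by fun_prop)).mul_const _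

theorem integral_deriv_quadInterp_last (hα1 : α < 1) (ht : StrictMono t) (v : ℕ → ℝ) {k : ℕ}
    (hk : 2 ≤ k) :
    ∫ s in (t (k - 1))..(t k), deriv (quadInterp t v (k - 1)) s / (t k - s) ^ α
      = -coefA α t k k * (v (k - 1) - v (k - 2)) + coefC α t k k * (v k - v (k - 1)) := by
  obtain ⟨k, rfl⟩ : ∃ m, k = m + 2 := ⟨k - 2, by omega⟩
  have hm := ht.monotone ((k + 1).le_succ)
  rw [coefA, coefC, if_neg (lt_irrefl _), if_neg (lt_irrefl _)]
  simp only [show k + 2 - 1 = k + 1 by omega, show k + 2 - 2 = k by omega]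
  rw [← intervalIntegral.integral_neg, ← intervalIntegral.integral_mul_const,
    ← intervalIntegral.integral_mul_const, ← intervalIntegral.integral_add]
  · congr 1
    ext s
    rw [deriv_quadInterp ht]
    ring
  · exact (IntervalIntegrable.neg (intervalIntegrable_ker hα1 hm le_rfl (by fun_prop))).mul_const _
  · exact (intervalIntegrable_ker hα1 hm le_rfl (by fun_prop)).mul_const _

/-- Each interior increment receives c from the interval before it and -a from its own, which is d.
The last c has no partner and stays apart. -/
theorem sum_kerA_kerC (K : ℝ → ℝ) (v : ℕ → ℝ) (m : ℕ) :
    ∑ j ∈ Finset.Icc 1 (m + 1), (-kerA t K j * (v j - v (j - 1)) + kerC t K j * (v (j + 1) - v j))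
      = ∑ p ∈ Finset.range (m + 1), kerD t K (p + 1) * (v (p + 1) - v p)
        + kerC t K (m + 1) * (v (m + 2) - v (m + 1)) := by
  induction m with
  | zero => simp [kerD]
  | succ m ih =>
    rw [Finset.sum_Icc_succ_top (by omega), ih, Finset.sum_range_succ _ (m + 1)]
    simp only [kerD, show m + 1 + 1 = m + 2 by omega, show m + 2 - 1 = m + 1 by omega]
    ring_nf

/-- The operator `L_k^α` as a combination of increments. -/
theorem gamma_mul_fracL2 (hα1 : α < 1) (ht : StrictMono t) (v : ℕ → ℝ) (m : ℕ) :
    Real.Gamma (1 - α) * fracL2 α t v (m + 2)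
      = ∑ p ∈ Finset.range (m + 1), kerD t (ker α t (m + 2)) (p + 1) * (v (p + 1) - v p)
        - coefA α t (m + 2) (m + 2) * (v (m + 1) - v m)
        + (coefC α t (m + 2) (m + 1) + coefC α t (m + 2) (m + 2)) * (v (m + 2) - v (m + 1)) := by
  have hG : Real.Gamma (1 - α) ≠ 0 := (Real.Gamma_pos_of_pos (by linarith)).ne'
  rw [fracL2, if_neg (by omega), ← mul_assoc, mul_one_div_cancel hG, one_mul,
    integral_deriv_quadInterp_last hα1 ht v (by omega),
    show m + 2 - 1 = m + 1 by omega, show m + 2 - 2 = m by omega]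
  have : ∀ j ∈ Finset.Icc 1 (m + 1),
      ∫ s in (t (j - 1))..(t j), deriv (quadInterp t v j) s / (t (m + 2) - s) ^ α
      = -kerA t (ker α t (m + 2)) j * (v j - v (j - 1))
        + kerC t (ker α t (m + 2)) j * (v (j + 1) - v j) := by
    intro j hj
    rw [Finset.mem_Icc] at hj
    rw [integral_deriv_quadInterp_of_lt hα1 ht v hj.1 (by omega), coefA_of_lt (by omega),
      coefC_of_lt (by omega)]
  rw [Finset.sum_congr rfl this, sum_kerA_kerC, coefC_of_lt (j := m + 1) (by omega)]
  ring

end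

/-! ### The constants -/

theorem rhoR_sq : rhoR ^ 2 = 3 * rhoR + 2 := by
  have := Real.sq_sqrt (show (0 : ℝ) ≤ 17 by norm_num)
  unfold rhoR
  linear_combination this / 4

theorem rhoR_lt : rhoR < 3.5616 := by
  have : Real.sqrt 17 < 4.1232 := by
    rw [Real.sqrt_lt' (by norm_num)]; norm_num
  unfold rhoR
  linarith

theorem lt_rhoR : 3.56 < rhoR := by
  have : 4.12 < Real.sqrt 17 := by
    apply Real.lt_sqrt_of_sq_lt; norm_num
  unfold rhoR
  linarith

theorem rhoL_pos : 0 < rhoL := (existsUnique_cubic rhoR_pos).choose_spec.1.1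

theorem cubic_eq_of_div {r y : ℝ} (hy : 0 < y)
    (h : r ^ 2 * (1 + r) / (1 - 3 * r ^ 2 * (1 + r)) = y) :
    r ^ 2 * (1 + r) * (1 + 3 * y) = y := by
  have hd : 1 - 3 * r ^ 2 * (1 + r) ≠ 0 := by
    intro h'; rw [h', div_zero] at h; exact hy.ne h
  rw [div_eq_iff hd] at h
  linarith

theorem rhoL_eq : rhoL ^ 2 * (1 + rhoL) * (1 + 3 * rhoR) = rhoR :=
  cubic_eq_of_div rhoR_pos (existsUnique_cubic rhoR_pos).choose_spec.1.2

theorem xi1_eq : xi1 ^ 2 * (1 + xi1) * (1 + 3 * rhoUp) = rhoUp :=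
  cubic_eq_of_div rhoUp_pos (existsUnique_cubic rhoUp_pos).choose_spec.1.2

theorem lt_rhoL : 0.457 < rhoL := by
  have h := rhoL_eq
  by_contra hcon
  push Not at hcon
  have h0 := rhoL_pos
  have h1 : rhoL ^ 2 * (1 + rhoL) ≤ 0.457 ^ 2 * (1 + 0.457) := by gcongr
  have h2 : rhoL ^ 2 * (1 + rhoL) * (1 + 3 * rhoR) ≤ 0.457 ^ 2 * (1 + 0.457) * (1 + 3 * rhoR) :=
    mul_le_mul_of_nonneg_right h1 (by linarith [rhoR_pos])
  have := lt_rhoR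
  norm_num at h2
  linarith

theorem rhoLow_lt : rhoLow < 0.4 := by
  obtain ⟨h0, h⟩ := existsUnique_rhoLow.choose_spec.1
  change 0 < rhoLow at h0
  change rhoLow * (1 + rhoLow) = 1 - 3 * rhoLow ^ 2 * (1 + rhoLow) at h
  by_contra hcon
  push Not at hcon
  have h1 : (0.4 : ℝ) * (1 + 0.4) ≤ rhoLow * (1 + rhoLow) := by gcongr
  have h2 : 3 * (0.4 : ℝ) ^ 2 * (1 + 0.4) ≤ 3 * rhoLow ^ 2 * (1 + rhoLow) := by gcongr
  norm_num at h1 h2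
  linarith

theorem rhoLow_pos : 0 < rhoLow := existsUnique_rhoLow.choose_spec.1.1

theorem lt_rhoUp : 4 < rhoUp := by
  have h0 := rhoLow_pos
  have h1 := rhoLow_lt
  have e1 : (4 + 3 * rhoLow) / (1 + rhoLow) = 3 + 1 / (1 + rhoLow) := by field_simp; ring
  have e2 : (2 + rhoLow) / (1 + rhoLow) = 1 + 1 / (1 + rhoLow) := by field_simp; ring
  have h3 : 0.7 < 1 / (1 + rhoLow) := by
    rw [lt_div_iff₀ (by linarith)]; linarith
  have h4 : 4.3 < Real.sqrt ((3 + 1 / (1 + rhoLow)) ^ 2 + 4 * (1 + 1 / (1 + rhoLow))) := by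
    apply Real.lt_sqrt_of_sq_lt
    nlinarith
  rw [rhoUp, e1, e2]
  linarith

/-- The quadratic satisfied by `ξ_2`. -/
theorem xi2_eq : 0 < xi2 ∧ (1 + rhoUp) * xi2 ^ 2 - (4 + 3 * rhoUp) * xi2 - (2 + rhoUp) = 0 := by
  obtain ⟨h0, h⟩ := (existsUnique_quad rhoUp_pos).choose_spec.1
  change 0 < xi2 at h0
  change (-xi2 ^ 2 + 4 * xi2 + 2) / (xi2 ^ 2 - 3 * xi2 - 1) = rhoUp at h
  have hd : xi2 ^ 2 - 3 * xi2 - 1 ≠ 0 := by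
    intro h'; rw [h', div_zero] at h; exact rhoUp_pos.ne h
  rw [div_eq_iff hd] at h
  exact ⟨h0, by linarith⟩

theorem quad_xi2_pos : 0 < xi2 ^ 2 - 3 * xi2 - 1 := by
  obtain ⟨h0, h⟩ := xi2_eq
  have hU := rhoUp_pos
  have : (1 + rhoUp) * (xi2 ^ 2 - 3 * xi2 - 1) = 1 + xi2 := by linarith
  exact pos_of_mul_pos_right (a := 1 + rhoUp) (by rw [this]; linarith) (by linarith)

/-! ### The constraints -/

theorem initialConstraint_of_mem {t : ℕ → ℝ}
    (hρ : ∀ k : ℕ, 2 ≤ k → rho t k ∈ Set.Icc rhoL rhoR) : InitialConstraint t := by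
  have h2 := hρ 2 le_rfl
  have h3 := hρ 3 (by norm_num)
  have a1 := rhoLow_lt
  have a2 := lt_rhoL
  have a3 := rhoR_lt
  have a4 := lt_rhoUp
  refine ⟨by linarith [h2.1], by linarith [h3.1], by linarith [h3.2], ?_⟩
  have x0 : 0 < rho t 3 := by linarith [h3.1]
  have y0 : 0 < rho t 2 := by linarith [h2.1]
  have y1 : rho t 2 ≤ 3.5616 := by linarith [h2.2]
  -- This is y^2 ≤ 4 (1 + y) for y = ρ_2, so the positive fraction already absorbs the negative one.
  have : rho t 2 ^ 3 / (1 + rho t 2) ^ 2 ≤ 4 * rho t 2 / (1 + rho t 2) := by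
    rw [div_le_div_iff₀ (by positivity) (by positivity)]
    have : 0 ≤ rho t 2 * (1 + rho t 2) * (4 * (1 + rho t 2) - rho t 2 ^ 2) :=
      mul_nonneg (by positivity) (by nlinarith)
    linarith
  have : 0 ≤ 2 / (1 + rho t 3) := by positivity
  linarith

theorem stepConstraint_of_mem {t : ℕ → ℝ}
    (hρ : ∀ k : ℕ, 2 ≤ k → rho t k ∈ Set.Icc rhoL rhoR) {k : ℕ} (hk : 2 ≤ k) :
    StepConstraint t k := by
  have h2 := hρ k hk
  have h3 := hρ (k + 1) (by omega)
  have a1 := rhoLow_lt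
  have a2 := lt_rhoL
  have a3 := rhoR_lt
  have a4 := lt_rhoUp
  have hR := rhoR_pos
  have hL := rhoL_pos
  unfold StepConstraint
  generalize rho t k = y at *
  generalize rho t (k + 1) = x at *
  have y0 : 0 < y := by linarith [h2.1]
  rcases lt_or_ge y xi1 with hy | hy
  -- The upper bound is increasing in y where its denominator is positive, and it equals ρ_R at y =
  -- ρ_L.
  · refine Or.inl ⟨by linarith [h2.1], hy, by linarith [h3.1], h3.2.trans ?_⟩
    have b1 : y ^ 2 * (1 + y) ≤ xi1 ^ 2 * (1 + xi1) := by gcongr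
    have b2 : rhoL ^ 2 * (1 + rhoL) ≤ y ^ 2 * (1 + y) := by gcongr <;> exact h2.1
    have b3 := xi1_eq
    have b4 := rhoL_eq
    have b5 : 0 < 1 - 3 * y ^ 2 * (1 + y) := by
      have : 3 * (xi1 ^ 2 * (1 + xi1)) < 1 := by
        by_contra hcon
        push Not at hcon
        nlinarith
      linarith
    rw [le_div_iff₀ b5]
    have := mul_le_mul_of_nonneg_right b2 (show 0 ≤ 1 + 3 * rhoR by linarith)
    linarith
  · right
    rcases le_or_gt y xi2 with hy2 | hy2
    · exact Or.inl ⟨hy, hy2, by linarith [h3.1], by linarith [h3.2]⟩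
    · refine Or.inr ⟨hy2, by linarith [h2.2], by linarith [h3.1], h3.2.trans ?_⟩
      have b1 := quad_xi2_pos
      have b0 := xi2_eq.1
      have b2 : 0 < y ^ 2 - 3 * y - 1 := by
        have : 3 < xi2 := by nlinarith
        nlinarith
      rw [le_div_iff₀ b2]
      have := rhoR_sq
      have h4 := h2.2
      -- `ρ_R` is a fixed point of the right-hand side
      have : 0 ≤ (rhoR - y) * ((1 + rhoR) * (rhoR + y) - (4 + 3 * rhoR)) :=
        mul_nonneg (by linarith) (by nlinarith)
      nlinarith

/-- Each side is monotone in its own ratio, so the extreme pair (ρ_L, ρ_R) decides, and there the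
equation for ρ_L gives equality. -/
theorem ratioCondition_of_mem {t : ℕ → ℝ}
    (hρ : ∀ k : ℕ, 2 ≤ k → rho t k ∈ Set.Icc rhoL rhoR) {k : ℕ} (hk : 2 ≤ k) :
    RatioCondition t k := by
  have h2 := hρ k hk
  have h3 := hρ (k + 1) (by omega)
  have hR := rhoR_pos
  have hL := rhoL_pos
  have e : 1 / (rhoL ^ 2 * (1 + rhoL)) = 1 / rhoR + 3 := by
    have := rhoL_eq
    field_simp
    linarith
  have x0 : 0 < rho t (k + 1) := by linarith [h3.1]
  have y0 : 0 < rho t k := by linarith [h2.1]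
  calc 1 / (rho t k ^ 2 * (1 + rho t k)) ≤ 1 / (rhoL ^ 2 * (1 + rhoL)) := by
        have := h2.1
        gcongr
    _ = 1 / rhoR + 3 := e
    _ ≤ 1 / rho t (k + 1) + 3 := by
        have := h3.2
        gcongr

/-! ### Scalar inequalities -/

/-- The ρ_{k+1} half of the positivity of g_k; `quad_div_le_of_le_rhoR` is the ρ_k half. With b = 1
- α and the denominator 1 + x cleared, Bernoulli bounds on the powers leave a polynomial in b
without constant term, whose coefficients of b and b^2 are positive on the range. -/
theorem one_add_inv_lt_of_le_rhoR {α x : ℝ} (hα0 : 0 < α) (hα1 : α < 1) (hx0 : 0 < x)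
    (hx : x ≤ rhoR) :
    1 + 1 / (1 + x) < (1 + α) * (2 - α) / α + (x - 1 + α) / (1 + x) ^ α
      - 2 * x ^ (2 - α) / (1 + x) := by
  obtain ⟨b, rfl⟩ : ∃ b, α = 1 - b := ⟨1 - α, by ring⟩
  have hb0 : 0 < b := by linarith
  have hb1 : b < 1 := by linarith
  set r := Real.sqrt x with hr
  have hr0 : 0 < r := Real.sqrt_pos.2 hx0
  have hrx : r ^ 2 = x := Real.sq_sqrt hx0.le
  have hr1 : r < 1.8873 := by
    have := rhoR_lt
    nlinarith
  -- Bernoulli for r = √x, then squared. Applied to x itself it would leave the b-coefficient 2 + 5x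
  -- - 2x^2, which is negative at ρ_R.
  have hxb : x ^ b ≤ (1 + b * (r - 1)) ^ 2 := by
    have h := rpow_one_add_le_one_add_mul_self (s := r - 1) (p := b) (by linarith) hb0.le
      hb1.le
    rw [show 1 + (r - 1) = r by ring] at h
    rw [← hrx, ← Real.rpow_natCast, ← Real.rpow_mul hr0.le, mul_comm, Real.rpow_mul hr0.le,
      Real.rpow_natCast]
    exact pow_le_pow_left₀ (Real.rpow_nonneg hr0.le _) h 2
  have h1x : (x - b) * (1 + x) ^ b ≥ x - b - b / 4 ∧ (b ≤ x → (x - b) * (1 + x) ^ b ≥ x - b) := by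
    have h1 : 1 ≤ (1 + x) ^ b := Real.one_le_rpow (by linarith) hb0.le
    have h2 : (1 + x) ^ b ≤ 1 + b * x :=
      rpow_one_add_le_one_add_mul_self (by linarith) hb0.le hb1.le
    have h3 : b ≤ x → (x - b) * (1 + x) ^ b ≥ x - b := fun h => by nlinarith
    refine ⟨?_, h3⟩
    rcases le_total b x with h | h
    · linarith [h3 h]
    · have h4 : (b - x) * (1 + x) ^ b ≤ (b - x) * (1 + b * x) :=
        mul_le_mul_of_nonneg_left h2 (by linarith)
      have h5 : x * (b - x) ≤ 1 / 4 := by nlinarith [sq_nonneg (x - b / 2)]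
      nlinarith
  have e1 : (x - 1 + (1 - b)) / (1 + x) ^ (1 - b) = (x - b) * (1 + x) ^ b / (1 + x) := by
    rw [Real.rpow_sub (by linarith), Real.rpow_one]
    field_simp
    ring
  have e2 : x ^ (2 - (1 - b)) = x * x ^ b := by
    rw [show 2 - (1 - b) = 1 + b by ring, Real.rpow_add hx0, Real.rpow_one]
  have e3 : 2 + 3 * b + 2 * b ^ 2 ≤ (1 + (1 - b)) * (2 - (1 - b)) / (1 - b) := by
    rw [le_div_iff₀ (by linarith)]
    nlinarith [pow_pos hb0 3]
  rw [e1, e2]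
  refine lt_of_lt_of_le ?_ (sub_le_sub_right (add_le_add_left e3 _) _)
  rw [← sub_pos]
  have e4 : 2 + 3 * b + 2 * b ^ 2 + (x - b) * (1 + x) ^ b / (1 + x) - 2 * (x * x ^ b) / (1 + x)
      - (1 + 1 / (1 + x))
      = ((1 + 3 * b + 2 * b ^ 2) * (1 + x) + (x - b) * (1 + x) ^ b - 2 * (x * x ^ b) - 1)
        / (1 + x) := by
    field_simp
    ring
  rw [e4]
  apply div_pos _ (by linarith)
  have h6 : x * x ^ b ≤ x * (1 + b * (r - 1)) ^ 2 := mul_le_mul_of_nonneg_left hxb hx0.le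
  have h7 : 0 < 2 * (1 + x) - 2 * x * (r - 1) ^ 2 := by
    rcases le_total r 1 with h | h
    · have : (r - 1) ^ 2 ≤ 1 := by nlinarith
      nlinarith
    · have : (r - 1) ^ 2 ≤ 1 := by nlinarith
      nlinarith
  have h8 : 0 < b ^ 2 * (2 * (1 + x) - 2 * x * (r - 1) ^ 2) := by positivity
  rcases le_total b x with h | h
  · have h9 := h1x.2 h
    -- A narrow margin: at the extreme r = 1.8873, x = 3.5616 the product x (7 - 4r) is about
    -- -1.956.
    have h10 : 0 < b * (2 + x * (7 - 4 * r)) := by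
      apply mul_pos hb0
      have := rhoR_lt
      nlinarith
    nlinarith
  · have h9 := h1x.1
    have h10 : 0 < b * (2 + x * (7 - 4 * r) - 1 / 4) := by
      apply mul_pos hb0
      have : r ≤ 1 := by nlinarith
      nlinarith
    nlinarith

/-- Equality holds at y = ρ_R because ρ_R^2 = 3ρ_R + 2; the factor ρ_R - y then splits off. -/
theorem quad_div_le_of_le_rhoR {y : ℝ} (hy0 : 0 < y) (hy : y ≤ rhoR) :
    y * (y - 2) / (1 + y) ≤ 1 + 1 / (1 + rhoR) := by
  have hR := rhoR_pos
  have := rhoR_sq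
  rw [div_le_iff₀ (by linarith), ← sub_nonneg]
  have e : (1 + 1 / (1 + rhoR)) * (1 + y) - y * (y - 2)
      = (rhoR - y) * (rhoR - 2 + y * (1 + rhoR)) / (1 + rhoR) := by
    field_simp
    linear_combination (-(1 + y)) * this
  rw [e]
  exact div_nonneg (mul_nonneg (by linarith) (by nlinarith [lt_rhoR])) (by linarith)

/-! ### The smaller eigenvalue of a symmetric `2 × 2` matrix -/

theorem smallEigenvalue_pos {P Q R : ℝ} (hP : 0 < P) (hR : 0 < R) (h : Q ^ 2 < P * R) :
    0 < (P + R - Real.sqrt ((P - R) ^ 2 + 4 * (Q * Q))) / 2 := by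
  have : Real.sqrt ((P - R) ^ 2 + 4 * (Q * Q)) < P + R := by
    rw [Real.sqrt_lt' (by linarith)]
    nlinarith
  linarith

/-- Cauchy–Schwarz for (P - R, 2Q) and (a^2 - b^2, 2ab), the latter having length a^2 + b^2. -/
theorem smallEigenvalue_mul_le (P Q R a b : ℝ) :
    (P + R - Real.sqrt ((P - R) ^ 2 + 4 * (Q * Q))) / 2 * (a ^ 2 + b ^ 2)
      ≤ P * a ^ 2 + 2 * Q * a * b + R * b ^ 2 := by
  set S := Real.sqrt ((P - R) ^ 2 + 4 * (Q * Q))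
  have hS : S ^ 2 = (P - R) ^ 2 + 4 * (Q * Q) := Real.sq_sqrt (by nlinarith [sq_nonneg (P - R), sq_nonneg Q])
  have hS0 : 0 ≤ S := Real.sqrt_nonneg _
  have h : |(P - R) * (a ^ 2 - b ^ 2) + 2 * Q * (2 * a * b)| ≤ S * (a ^ 2 + b ^ 2) := by
    apply abs_le_of_sq_le_sq _ (by positivity)
    rw [mul_pow, hS]
    nlinarith [sq_nonneg ((P - R) * (2 * a * b) - 2 * Q * (a ^ 2 - b ^ 2))]
  have := (abs_le.1 h).1
  linarith

/-! ### Lower bounds for the diagonal -/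

section

variable {α : ℝ} {t : ℕ → ℝ}

theorem convexKernel_ker_t (hα0 : 0 < α) (ht : StrictMono t) (a : ℝ) {k m : ℕ} (hm : m < k) :
    ConvexKernel (ker α t k) (fun s => α * (t k - s) ^ (-α - 1)) a (t m) :=
  convexKernel_ker hα0 (ht hm)

theorem convexKernel_ker_t_sub (hα0 : 0 < α) (ht : StrictMono t) (a : ℝ) {k m : ℕ} (hm : m < k) :
    ConvexKernel (fun s => ker α t k s - ker α t (k + 1) s)
      (fun s => α * (t k - s) ^ (-α - 1) - α * (t (k + 1) - s) ^ (-α - 1)) a (t m) :=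
  convexKernel_ker_sub hα0 (ht hm) (ht.monotone k.le_succ)

theorem kerD_le {K K' : ℝ → ℝ} (ht : StrictMono t) {m : ℕ}
    (h : ConvexKernel K K' (t 0) (t (m + 1))) (hr : ∀ k, 2 ≤ k → RatioCondition t k) :
    kerD t K (m + 1) ≤ K (t (m + 1)) + kerC t K (m + 1) := by
  match m with
  | 0 =>
    have h1 := neg_le_kerA ht h
    have h2 := kerC_nonneg ht h
    simp only [kerD, zero_add] at *
    linarith
  | m + 1 =>
    have := kerC_le_of_ratioCondition ht (h.subset (ht.monotone (Nat.zero_le m)) le_rfl)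
      (hr _ (by omega))
    simp only [kerD]
    linarith

theorem le_diag_last (hα0 : 0 < α) (hα1 : α < 1) (ht : StrictMono t)
    (hr : ∀ k, 2 ≤ k → RatioCondition t k) (m : ℕ) :
    α / ((1 - α) * (2 - α) * tau t (m + 2) ^ α)
        * ((1 + α) * (2 - α) / α + 2 * rho t (m + 2) / (1 + rho t (m + 2)))
      ≤ 2 * (coefC α t (m + 2) (m + 1) + coefC α t (m + 2) (m + 2))
        - kerD t (ker α t (m + 2)) (m + 1) := by
  have hK := convexKernel_ker_t hα0 ht (t 0) (show m + 1 < m + 2 by omega)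
  have h1 := kerD_le ht hK hr
  have h2 := kerC_nonneg ht (hK.subset (ht.monotone (Nat.zero_le m)) le_rfl)
  have h3 := coefC_self hα1 ht (show 2 ≤ m + 2 by omega)
  have hA : 0 < tau t (m + 2) ^ α := Real.rpow_pos_of_pos (tau_pos ht (by omega)) _
  have hy := rho_pos ht (show 2 ≤ m + 2 by omega)
  rw [coefC_of_lt (show m + 1 < m + 2 by omega), h3]
  have e : ker α t (m + 2) (t (m + 1)) = 1 / tau t (m + 2) ^ α := by simp [ker, tau]
  rw [e] at h1
  generalize rho t (m + 2) = y at *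
  generalize tau t (m + 2) ^ α = A at *
  have a1 : 0 < 1 - α := by linarith
  have a2 : 0 < 2 - α := by linarith
  have : α / ((1 - α) * (2 - α) * A) * ((1 + α) * (2 - α) / α + 2 * y / (1 + y))
      = 2 * ((2 * y + 2 - α) / (1 + y) / ((1 - α) * (2 - α) * A)) - 1 / A := by
    field_simp
    ring
  linarith

/-- The bound `kerD_le` is applied to the difference of the kernels of rows m + 2 and m + 3. The
term c_{m+1}^{m+3} then cancels, a copy of c_{m+1}^{m+2} ≥ 0 is dropped, and only coefficients with
closed forms remain. -/
theorem le_diag_mid (hα0 : 0 < α) (hα1 : α < 1) (ht : StrictMono t)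
    (hr : ∀ k, 2 ≤ k → RatioCondition t k) (m : ℕ) :
    α / ((1 - α) * (2 - α) * tau t (m + 2) ^ α)
        * ((1 + α) * (2 - α) / α + (rho t (m + 3) - 1 + α) / (1 + rho t (m + 3)) ^ α
          - 2 * rho t (m + 3) ^ (2 - α) / (1 + rho t (m + 3))
          + 2 * rho t (m + 2) / (1 + rho t (m + 2)))
      ≤ 2 * (coefC α t (m + 2) (m + 1) + coefC α t (m + 2) (m + 2))
        - kerD t (ker α t (m + 2)) (m + 1)
        - (kerD t (ker α t (m + 3)) (m + 2) - kerD t (ker α t (m + 3)) (m + 1)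
          + coefA α t (m + 3) (m + 3)) := by
  have hK := convexKernel_ker_t hα0 ht (t 0) (show m + 1 < m + 2 by omega)
  have hL := convexKernel_ker_t hα0 ht (t 0) (show m + 1 < m + 3 by omega)
  have hKL := convexKernel_ker_t_sub hα0 ht (t 0) (show m + 1 < m + 2 by omega)
  have hsub : Set.Icc (t m) (t (m + 1)) ⊆ Set.Icc (t 0) (t (m + 1)) :=
    Set.Icc_subset_Icc (ht.monotone (Nat.zero_le m)) le_rfl
  have h1 := kerD_le ht hKL hr
  have h2 := kerC_nonneg ht (hK.subset (ht.monotone (Nat.zero_le m)) le_rfl)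
  have h3 := coefC_self hα1 ht (show 2 ≤ m + 2 by omega)
  have h4 := coefA_self hα1 ht (show 2 ≤ m + 3 by omega)
  have h5 := coefA_succ hα1 ht (show 1 ≤ m + 2 by omega)
  rw [show m + 2 + 1 = m + 3 by omega] at h1 h5
  rw [kerD_sub ht hK.continuousOn hL.continuousOn le_rfl,
    kerC_sub ht (hK.continuousOn.mono hsub) (hL.continuousOn.mono hsub)] at h1
  rw [coefC_of_lt (show m + 1 < m + 2 by omega), h3, h4]
  have hD : kerD t (ker α t (m + 3)) (m + 2)
      = kerC t (ker α t (m + 3)) (m + 1) - coefA α t (m + 3) (m + 2) := by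
    rw [coefA_of_lt (by omega), kerD]
  rw [hD, h5]
  have p2 := tau_pos ht (show 1 ≤ m + 2 by omega)
  have p3 := tau_pos ht (show 1 ≤ m + 3 by omega)
  have hA : 0 < tau t (m + 2) ^ α := Real.rpow_pos_of_pos p2 _
  have hy := rho_pos ht (show 2 ≤ m + 2 by omega)
  have hx := rho_pos ht (show 2 ≤ m + 3 by omega)
  have e3 : tau t (m + 3) = tau t (m + 2) * rho t (m + 3) := by
    rw [rho, show m + 3 - 1 = m + 2 by omega]; field_simp
  have e1 : ker α t (m + 2) (t (m + 1)) = 1 / tau t (m + 2) ^ α := by simp [ker, tau]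
  have e2 : ker α t (m + 3) (t (m + 1)) = 1 / (tau t (m + 2) ^ α * (1 + rho t (m + 3)) ^ α) := by
    rw [← Real.mul_rpow p2.le (by linarith), mul_add, mul_one, ← e3, ker]
    congr 2
    simp [tau]
  rw [e1, e2] at h1
  rw [e3, Real.mul_rpow p2.le hx.le, Real.rpow_sub hx, Real.rpow_two]
  have hB : 0 < rho t (m + 3) ^ α := Real.rpow_pos_of_pos hx _
  have hC : 0 < (1 + rho t (m + 3)) ^ α := Real.rpow_pos_of_pos (by linarith) _
  generalize (1 + rho t (m + 3)) ^ α = C at *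
  generalize rho t (m + 3) ^ α = B at *
  generalize rho t (m + 3) = x at *
  generalize rho t (m + 2) = y at *
  generalize tau t (m + 2) ^ α = A at *
  have a1 : 0 < 1 - α := by linarith
  have a2 : 0 < 2 - α := by linarith
  have : α / ((1 - α) * (2 - α) * A) * ((1 + α) * (2 - α) / α + (x - 1 + α) / C
        - 2 * (x ^ 2 / B) / (1 + x) + 2 * y / (1 + y))
      = 2 * ((2 * y + 2 - α) / (1 + y) / ((1 - α) * (2 - α) * A)) - (1 / A - 1 / (A * C))
        + ((α * x - 2 + 2 * α) / C - α * (x ^ 2 / B) / (1 + x)) / ((1 - α) * (2 - α) * A)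
        - α * (x ^ 2 / (1 + x)) / ((1 - α) * (2 - α) * (A * B)) := by
    field_simp
    ring
  linarith

/-! ### Positivity of `g` -/

theorem matC_zero_zero : matC α t 0 0 = 2 * (1 - α)⁻¹ * tau t 1 ^ (-α) + coefA α t 2 1 := by
  simp [matC, beta1]
  ring

theorem matC_one_one : matC α t 1 1
    = 2 * (coefC α t 2 1 + coefC α t 2 2) - kerD t (ker α t 2) 1
      - (kerD t (ker α t 3) 2 - kerD t (ker α t 3) 1 + coefA α t 3 3) := by
  simp only [matC, beta2, coefD, kerD, Matrix.cons_val', Matrix.cons_val_one, Matrix.of_apply,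
    Matrix.cons_val_fin_one, coefA_of_lt (show 1 < 3 by omega), coefA_of_lt (show 2 < 3 by omega),
    coefA_of_lt (show 1 < 2 by omega), coefC_of_lt (show 1 < 3 by omega), Nat.reduceSub,
    Nat.reduceAdd]
  ring

theorem gHat_eq : gHat α t = (matC α t 0 0 + matC α t 1 1
    - Real.sqrt ((matC α t 0 0 - matC α t 1 1) ^ 2 + 4 * (coefA α t 2 2 * coefA α t 2 2))) / 2 := by
  simp [gHat, matC]

/-- The bound is 2 / ((1-α)(2-α) τ_1^α), written with τ_2 to share its denominator with the bounds
for the other entries. The excess is nonnegative since (1 + y)^α ≥ 1 and y/(1+y) ≤ (y/(1+y))^α for y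
= ρ_2. -/
theorem le_matC_zero_zero (hα0 : 0 < α) (hα1 : α < 1) (ht : StrictMono t) :
    2 * rho t 2 ^ α / ((1 - α) * (2 - α) * tau t 2 ^ α) ≤ matC α t 0 0 := by
  have p1 := tau_pos ht (show 1 ≤ 1 by omega)
  have p2 := tau_pos ht (show 1 ≤ 2 by omega)
  have hy := rho_pos ht (show 2 ≤ 2 by omega)
  have e2 : tau t 2 = tau t 1 * rho t 2 := by
    rw [rho]; field_simp
  rw [matC_zero_zero, coefA_succ hα1 ht le_rfl, e2, Real.mul_rpow p1.le hy.le, Real.rpow_neg p1.le,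
    Real.rpow_sub hy, Real.rpow_two]
  simp only [Nat.reduceAdd]
  have hA : 0 < tau t 1 ^ α := Real.rpow_pos_of_pos p1 _
  have hB : 0 < rho t 2 ^ α := Real.rpow_pos_of_pos hy _
  have hC : 1 ≤ (1 + rho t 2) ^ α := Real.one_le_rpow (by linarith) hα0.le
  have hBC : rho t 2 * (1 + rho t 2) ^ α ≤ rho t 2 ^ α * (1 + rho t 2) := by
    have h1 : (rho t 2 / (1 + rho t 2)) ^ (1 : ℝ) ≤ (rho t 2 / (1 + rho t 2)) ^ α :=
      Real.rpow_le_rpow_of_exponent_ge (by positivity) (by rw [div_le_one] <;> linarith) hα1.le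
    rw [Real.rpow_one, Real.div_rpow hy.le (by linarith), div_le_div_iff₀ (by linarith)
      (by linarith)] at h1
    exact h1
  generalize (1 + rho t 2) ^ α = C at *
  generalize rho t 2 ^ α = B at *
  generalize rho t 2 = y at *
  generalize tau t 1 ^ α = A at *
  have a1 : 0 < 1 - α := by linarith
  have a2 : 0 < 2 - α := by linarith
  have hC0 : 0 < C := by linarith
  rw [← sub_nonneg]
  have e : 2 * (1 - α)⁻¹ * A⁻¹ + ((α * y - 2 + 2 * α) / C - α * (y ^ 2 / B) / (1 + y))
        / ((1 - α) * (2 - α) * A) - 2 * B / ((1 - α) * (2 - α) * (A * B))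
      = (2 * (1 - α) * (C - 1) / C + α * y * (B * (1 + y) - y * C) / (B * C * (1 + y)))
        / ((1 - α) * (2 - α) * A) := by
    field_simp
    ring
  rw [e]
  have : 0 ≤ C - 1 := by linarith
  have : 0 ≤ B * (1 + y) - y * C := by linarith
  positivity

/-- This is det C > 0 after the diagonal entries are replaced by their lower bounds and common
factors are removed. -/
theorem lt_rpow_mul {y : ℝ} (hα0 : 0 < α) (hα1 : α < 1) (hy0 : 0 < y) (hy : y < 3.57) :
    α * y ^ 4 / (1 + y) ^ 2 < 2 * y ^ α * (1 + 2 * y / (1 + y)) := by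
  -- Bernoulli gives α y^(1-α) ≤ α + α(1-α)(y - 1) ≤ 1 + 2.57/4 < 1.65.
  have h1 : α * y ≤ 1.65 * y ^ α := by
    have h := rpow_one_add_le_one_add_mul_self (s := y - 1) (p := 1 - α) (by linarith)
      (by linarith) (by linarith)
    have e : y = y ^ α * y ^ (1 - α) := by
      rw [← Real.rpow_add hy0]; simp
    rw [show 1 + (y - 1) = y by ring] at h
    have hB : 0 < y ^ α := Real.rpow_pos_of_pos hy0 _
    calc α * y = y ^ α * (α * y ^ (1 - α)) := by nth_rewrite 1 [e]; ring
      _ ≤ y ^ α * 1.65 := by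
        apply mul_le_mul_of_nonneg_left _ hB.le
        have h2 : α * (1 - α) ≤ 1 / 4 := by nlinarith [sq_nonneg (α - 1 / 2)]
        have h3 : 0 < α * (1 - α) := mul_pos hα0 (by linarith)
        have h4 : α * (1 - α) * (y - 1) ≤ α * (1 - α) * 2.57 :=
          mul_le_mul_of_nonneg_left (by linarith) h3.le
        have h5 := mul_le_mul_of_nonneg_left h hα0.le
        nlinarith
      _ = _ := mul_comm _ _
  have h2 : y ^ 3 / (1 + y) ^ 2 * 1.65 < 2 * (1 + 2 * y / (1 + y)) := by
    have e : 2 * (1 + 2 * y / (1 + y)) = 2 * (1 + 4 * y + 3 * y ^ 2) / (1 + y) ^ 2 := by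
      field_simp
      ring
    rw [e, div_mul_eq_mul_div]
    apply div_lt_div_of_pos_right _ (by positivity)
    nlinarith [mul_pos hy0 hy0]
  have hB : 0 < y ^ α := Real.rpow_pos_of_pos hy0 _
  calc α * y ^ 4 / (1 + y) ^ 2 = α * y * (y ^ 3 / (1 + y) ^ 2) := by ring
    _ ≤ 1.65 * y ^ α * (y ^ 3 / (1 + y) ^ 2) := by gcongr
    _ = y ^ α * (y ^ 3 / (1 + y) ^ 2 * 1.65) := by ring
    _ < y ^ α * (2 * (1 + 2 * y / (1 + y))) := by gcongr
    _ = _ := by ring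

theorem gHat_pos (hα0 : 0 < α) (hα1 : α < 1) (ht : StrictMono t)
    (hρ : ∀ k : ℕ, 2 ≤ k → rho t k ∈ Set.Icc rhoL rhoR) : 0 < gHat α t := by
  have hy := rho_pos ht (show 2 ≤ 2 by omega)
  have hx := rho_pos ht (show 2 ≤ 3 by omega)
  have h1 := le_matC_zero_zero hα0 hα1 ht
  have h2 := le_diag_mid hα0 hα1 ht (fun k hk => ratioCondition_of_mem hρ hk) 0
  simp only [zero_add] at h2
  rw [← matC_one_one] at h2
  have h3 := one_add_inv_lt_of_le_rhoR hα0 hα1 hx (hρ 3 (by omega)).2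
  have h4 := lt_rpow_mul hα0 hα1 hy (by linarith [(hρ 2 le_rfl).2, rhoR_lt])
  have hi : 0 < 1 / (1 + rho t 3) := by positivity
  have a1 : 0 < 1 - α := by linarith
  have a2 : 0 < 2 - α := by linarith
  have hA : 0 < tau t 2 ^ α := Real.rpow_pos_of_pos (tau_pos ht (by omega)) _
  have hB : 0 < rho t 2 ^ α := Real.rpow_pos_of_pos hy _
  have hD : 0 < (1 - α) * (2 - α) * tau t 2 ^ α := by positivity
  rw [gHat_eq]
  have h5 : α / ((1 - α) * (2 - α) * tau t 2 ^ α) * (1 + 2 * rho t 2 / (1 + rho t 2))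
      ≤ matC α t 1 1 := by
    refine le_trans ?_ h2
    apply mul_le_mul_of_nonneg_left _ (by positivity)
    linarith
  have h6 : 0 < α / ((1 - α) * (2 - α) * tau t 2 ^ α) * (1 + 2 * rho t 2 / (1 + rho t 2)) := by
    positivity
  have h7 : 0 < 2 * rho t 2 ^ α / ((1 - α) * (2 - α) * tau t 2 ^ α) := by positivity
  apply smallEigenvalue_pos (h7.trans_le h1) (h6.trans_le h5)
  refine lt_of_lt_of_le ?_ (mul_le_mul h1 h5 h6.le (h7.le.trans h1))
  rw [coefA_self hα1 ht le_rfl]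
  generalize (1 - α) * (2 - α) * tau t 2 ^ α = D at *
  generalize rho t 2 ^ α = B at *
  generalize rho t 2 = y at *
  have e1 : (α * (y ^ 2 / (1 + y)) / D) ^ 2 = α * (α * y ^ 4 / (1 + y) ^ 2) / D ^ 2 := by
    field_simp
  have e2 : 2 * B / D * (α / D * (1 + 2 * y / (1 + y)))
      = α * (2 * B * (1 + 2 * y / (1 + y))) / D ^ 2 := by
    field_simp
  rw [e1, e2]
  gcongr

theorem g_pos (hα0 : 0 < α) (hα1 : α < 1) (ht : StrictMono t)
    (hρ : ∀ k : ℕ, 2 ≤ k → rho t k ∈ Set.Icc rhoL rhoR) (n : ℕ) {k : ℕ} (hk : 1 ≤ k) :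
    0 < g α t n k := by
  have a1 : 0 < 1 - α := by linarith
  have a2 : 0 < 2 - α := by linarith
  have hA : 0 < tau t k ^ α := Real.rpow_pos_of_pos (tau_pos ht hk) _
  unfold g
  split_ifs with h1 h2
  · have := gHat_pos hα0 hα1 ht hρ
    positivity
  · have hx := rho_pos ht (show 2 ≤ k + 1 by omega)
    have hxR := (hρ (k + 1) (by omega)).2
    have hF := one_add_inv_lt_of_le_rhoR hα0 hα1 hx hxR
    have hG := quad_div_le_of_le_rhoR (rho_pos ht (show 2 ≤ k by omega)) (hρ k (by omega)).2
    have hR : 1 / (1 + rhoR) ≤ 1 / (1 + rho t (k + 1)) := by gcongr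
    apply mul_pos (by positivity)
    linarith
  · have hG := quad_div_le_of_le_rhoR (rho_pos ht (show 2 ≤ k by omega)) (hρ k (by omega)).2
    have hR : 1 / (1 + rhoR) ≤ 1 / 2 := by
      have := lt_rhoR
      gcongr
      linarith
    have hF : 2 ≤ (1 + α) * (2 - α) / α := by
      rw [le_div_iff₀ hα0]; nlinarith
    apply mul_pos (by positivity)
    linarith

end

/-! ### The quadratic form of the increments -/

theorem sum_range_mul_eq_sum_sub_mul (f w : ℕ → ℝ) (hf : f 0 = 0) (n : ℕ) :
    ∑ p ∈ Finset.range n, f (p + 1) * w p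
      = ∑ p ∈ Finset.range n, (f (p + 1) - f p) * ∑ i ∈ Finset.Ico p n, w i := by
  induction n with
  | zero => simp
  | succ n ih =>
    have h1 : ∀ p ∈ Finset.range n, (f (p + 1) - f p) * ∑ i ∈ Finset.Ico p (n + 1), w i
        = (f (p + 1) - f p) * ∑ i ∈ Finset.Ico p n, w i + (f (p + 1) - f p) * w n := by
      intro p hp
      rw [Finset.sum_Ico_succ_top (Finset.mem_range.1 hp).le]
      ring
    rw [Finset.sum_range_succ, ih, Finset.sum_range_succ _ n, Finset.sum_congr rfl h1,
      Finset.sum_add_distrib, ← Finset.sum_mul, Finset.sum_range_sub, hf]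
    simp
    ring

/-- After Abel summation each term is 2 w_n S = (S + w_n)^2 - S^2 - w_n^2 with S a partial sum
ending before w_n; the weights of w_n^2 telescope to f n because f 0 = 0. -/
theorem two_mul_mul_sum (f w : ℕ → ℝ) (hf : f 0 = 0) (n : ℕ) :
    2 * w n * ∑ p ∈ Finset.range n, f (p + 1) * w p
      = ∑ p ∈ Finset.range n, (f (p + 1) - f p) * (∑ i ∈ Finset.Ico p (n + 1), w i) ^ 2
        - ∑ p ∈ Finset.range n, (f (p + 1) - f p) * (∑ i ∈ Finset.Ico p n, w i) ^ 2
        - f n * w n ^ 2 := by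
  have h0 : f n = ∑ p ∈ Finset.range n, (f (p + 1) - f p) := by
    rw [Finset.sum_range_sub, hf, sub_zero]
  rw [sum_range_mul_eq_sum_sub_mul f w hf, h0, Finset.mul_sum, Finset.sum_mul,
    ← Finset.sum_sub_distrib, ← Finset.sum_sub_distrib]
  apply Finset.sum_congr rfl
  intro p hp
  rw [Finset.sum_Ico_succ_top (Finset.mem_range.1 hp).le]
  ring

section

variable {α : ℝ} {t : ℕ → ℝ}

theorem kerD_ker_succ_sub_nonneg (hα0 : 0 < α) (ht : StrictMono t)
    (hr : ∀ k, 2 ≤ k → RatioCondition t k) {k p : ℕ} (hp : p + 1 < k) :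
    0 ≤ kerD t (ker α t k) (p + 1) - kerD t (ker α t k) p := by
  apply kerD_succ_sub_nonneg ht (convexKernel_ker_t hα0 ht _ hp) _ hr le_rfl
  exact one_div_nonneg.2 (Real.rpow_nonneg (sub_nonneg.2 (ht.monotone (Nat.zero_le k))) _)

theorem kerD_ker_succ_sub_le (hα0 : 0 < α) (ht : StrictMono t)
    (hr : ∀ k, 2 ≤ k → RatioCondition t k) {k p : ℕ} (hp : p + 1 < k) :
    kerD t (ker α t (k + 1)) (p + 1) - kerD t (ker α t (k + 1)) p
      ≤ kerD t (ker α t k) (p + 1) - kerD t (ker α t k) p := by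
  have hK := (convexKernel_ker_t hα0 ht (t 0) hp).continuousOn
  have hL := (convexKernel_ker_t hα0 ht (t 0) (show p + 1 < k + 1 by omega)).continuousOn
  have h0 : 0 ≤ ker α t k (t 0) - ker α t (k + 1) (t 0) := by
    have h1 : 0 < t k - t 0 := sub_pos.2 (ht (by omega))
    have h2 : t k < t (k + 1) := ht (by omega)
    rw [sub_nonneg, ker, ker]
    gcongr
  have := kerD_succ_sub_nonneg ht (convexKernel_ker_t_sub hα0 ht (t 0) hp) h0 hr le_rfl
  rw [kerD_sub ht hK hL le_rfl, kerD_sub ht hK hL (Nat.le_succ p)] at this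
  linarith

theorem coefA_self_nonneg (hα0 : 0 < α) (hα1 : α < 1) (ht : StrictMono t) {k : ℕ} (hk : 2 ≤ k) :
    0 ≤ coefA α t k k := by
  rw [coefA_self hα1 ht hk]
  have h1 := rho_pos ht hk
  have h2 := Real.rpow_pos_of_pos (tau_pos ht (show 1 ≤ k by omega)) α
  have a1 : 0 < 1 - α := by linarith
  have a2 : 0 < 2 - α := by linarith
  positivity

/-- The diagonal coefficient of row `m + 2` left after completing squares in the rows up to it. -/
def diagUp (α : ℝ) (t : ℕ → ℝ) (m : ℕ) : ℝ :=
  2 * (coefC α t (m + 2) (m + 1) + coefC α t (m + 2) (m + 2)) - kerD t (ker α t (m + 2)) (m + 1)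

/-- The amount that row `m + 3` takes from the diagonal coefficient of row `m + 2`. -/
def diagDown (α : ℝ) (t : ℕ → ℝ) (m : ℕ) : ℝ :=
  kerD t (ker α t (m + 3)) (m + 2) - kerD t (ker α t (m + 3)) (m + 1) + coefA α t (m + 3) (m + 3)

theorem gamma_mul_fracL2_one (hα1 : α < 1) (ht : StrictMono t) (v : ℕ → ℝ) :
    Real.Gamma (1 - α) * fracL2 α t v 1 = (1 - α)⁻¹ * tau t 1 ^ (-α) * (v 1 - v 0) := by
  have p1 := tau_pos ht (show 1 ≤ 1 by omega)
  have hA := Real.rpow_pos_of_pos p1 α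
  have hG := Real.Gamma_pos_of_pos (show 0 < 1 - α by linarith)
  have a1 : 1 - α ≠ 0 := by linarith
  rw [fracL2, if_pos rfl, show 2 - α = 1 - α + 1 by ring, Real.Gamma_add_one a1,
    Real.rpow_neg p1.le]
  field_simp

/-- Each diagonal coefficient is listed with the share `diagDown` of the following row already
deducted; for the newest increment that row is not yet present, so the share is added back. In this
form every new row consumes exactly the added term. For two rows the inequality is an identity. -/
theorem gamma_mul_sum_fracL2_ge (hα0 : 0 < α) (hα1 : α < 1) (ht : StrictMono t)
    (hr : ∀ k, 2 ≤ k → RatioCondition t k) (v w : ℕ → ℝ) (hw : ∀ i, w i = v (i + 1) - v i)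
    (m : ℕ) :
    ∑ p ∈ Finset.range (m + 1),
        (kerD t (ker α t (m + 2)) (p + 1) - kerD t (ker α t (m + 2)) p)
          * (∑ i ∈ Finset.Ico p (m + 2), w i) ^ 2
      + (matC α t 0 0 * w 0 ^ 2 + 2 * (-coefA α t 2 2) * w 0 * w 1 + matC α t 1 1 * w 1 ^ 2)
      + ∑ i ∈ Finset.range m,
          (diagUp α t (i + 1) - coefA α t (i + 3) (i + 3) - diagDown α t (i + 1)) * w (i + 2) ^ 2
      + diagDown α t m * w (m + 1) ^ 2
    ≤ 2 * (Real.Gamma (1 - α) * ∑ i ∈ Finset.range (m + 2), fracL2 α t v (i + 1) * w i) := by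
  induction m with
  | zero =>
    have h1 := gamma_mul_fracL2_one hα1 ht v
    have h2 := gamma_mul_fracL2 hα1 ht v 0
    have h3 : coefA α t 2 1 = kerA t (ker α t 2) 1 := coefA_of_lt (by omega)
    have h4 : ∑ i ∈ Finset.Ico 0 2, w i = w 0 + w 1 := by
      rw [← Finset.range_eq_Ico, Finset.sum_range_succ, Finset.sum_range_one]
    simp only [Finset.sum_range_succ, Finset.sum_range_zero, zero_add, Nat.reduceAdd, h4,
      show v 1 - v 0 = w 0 from (hw 0).symm, show v 2 - v 1 = w 1 from (hw 1).symm] at h1 h2 ⊢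
    rw [mul_add, ← mul_assoc, ← mul_assoc, h1, h2, matC_zero_zero, matC_one_one, h3]
    simp only [diagDown, kerD, zero_add]
    apply le_of_eq
    ring
  | succ m ih =>
    have h2 := gamma_mul_fracL2 hα1 ht v (m + 1)
    simp only [← hw, show m + 1 + 2 = m + 3 by omega, show m + 1 + 1 = m + 2 by omega] at h2 ⊢
    rw [Finset.sum_range_succ _ (m + 2), Finset.sum_range_succ _ m, mul_add (Real.Gamma (1 - α)),
      ← mul_assoc (Real.Gamma (1 - α)) (fracL2 α t v (m + 2 + 1)),
      show m + 2 + 1 = m + 3 by omega, h2]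
    have h3 := two_mul_mul_sum (kerD t (ker α t (m + 3))) w rfl (m + 2)
    rw [show m + 2 + 1 = m + 3 by omega, Finset.sum_range_succ (fun p =>
      (kerD t (ker α t (m + 3)) (p + 1) - kerD t (ker α t (m + 3)) p)
        * (∑ i ∈ Finset.Ico p (m + 2), w i) ^ 2) (m + 1)] at h3
    have h4 : ∑ p ∈ Finset.range (m + 1),
        (kerD t (ker α t (m + 3)) (p + 1) - kerD t (ker α t (m + 3)) p)
          * (∑ i ∈ Finset.Ico p (m + 2), w i) ^ 2
        ≤ ∑ p ∈ Finset.range (m + 1),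
        (kerD t (ker α t (m + 2)) (p + 1) - kerD t (ker α t (m + 2)) p)
          * (∑ i ∈ Finset.Ico p (m + 2), w i) ^ 2 := by
      -- The weights do not increase from row m + 2 to row m + 3, so the old positive squares cover
      -- the new negative ones.
      apply Finset.sum_le_sum
      intro p hp
      rw [Finset.mem_range] at hp
      exact mul_le_mul_of_nonneg_right (kerD_ker_succ_sub_le hα0 ht hr (by omega)) (sq_nonneg _)
    have h5 : ∑ i ∈ Finset.Ico (m + 1) (m + 2), w i = w (m + 1) := by simp
    rw [h5] at h3
    -- The cross term of the new row charges a_{m+3}^{m+3} to each of its two increments: one share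
    -- belongs to `diagDown`, the other to the new diagonal.
    have h6 : 2 * coefA α t (m + 3) (m + 3) * w (m + 1) * w (m + 2)
        ≤ coefA α t (m + 3) (m + 3) * (w (m + 1) ^ 2 + w (m + 2) ^ 2) := by
      have := mul_nonneg (coefA_self_nonneg hα0 hα1 ht (show 2 ≤ m + 3 by omega))
        (sq_nonneg (w (m + 1) - w (m + 2)))
      linarith
    have e1 : diagUp α t (m + 1) = 2 * (coefC α t (m + 3) (m + 2) + coefC α t (m + 3) (m + 3))
      - kerD t (ker α t (m + 3)) (m + 2) := rfl
    have e2 : diagDown α t m = kerD t (ker α t (m + 3)) (m + 2)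
      - kerD t (ker α t (m + 3)) (m + 1) + coefA α t (m + 3) (m + 3) := rfl
    rw [e1]
    rw [e2] at ih
    simp only [show m + 1 + 1 = m + 2 by omega] at h3
    linarith

theorem diagDown_nonneg (hα0 : 0 < α) (hα1 : α < 1) (ht : StrictMono t)
    (hr : ∀ k, 2 ≤ k → RatioCondition t k) (m : ℕ) : 0 ≤ diagDown α t m :=
  add_nonneg (kerD_ker_succ_sub_nonneg hα0 ht hr (by omega))
    (coefA_self_nonneg hα0 hα1 ht (by omega))

/-- The row's own cross term costs a further a_k^k, which turns 2y/(1+y) into -y(y-2)/(1+y), where y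
= ρ_k. -/
theorem g_mid_le (hα0 : 0 < α) (hα1 : α < 1) (ht : StrictMono t)
    (hr : ∀ k, 2 ≤ k → RatioCondition t k) {n m : ℕ} (hm : m + 3 < n) :
    g α t n (m + 3) / ((1 - α) * (2 - α))
      ≤ diagUp α t (m + 1) - coefA α t (m + 3) (m + 3) - diagDown α t (m + 1) := by
  have h := le_diag_mid hα0 hα1 ht hr (m + 1)
  have ha := coefA_self hα1 ht (show 2 ≤ m + 3 by omega)
  rw [g, if_neg (by omega), if_pos hm, diagUp, diagDown]
  simp only [show m + 1 + 2 = m + 3 by omega, show m + 1 + 3 = m + 4 by omega,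
    show m + 1 + 1 = m + 2 by omega] at h ⊢
  have hA : 0 < tau t (m + 3) ^ α := Real.rpow_pos_of_pos (tau_pos ht (by omega)) _
  have hy := rho_pos ht (show 2 ≤ m + 3 by omega)
  have a1 : 0 < 1 - α := by linarith
  have a2 : 0 < 2 - α := by linarith
  generalize rho t (m + 3) = y at *
  generalize tau t (m + 3) ^ α = A at *
  generalize (1 + α) * (2 - α) / α + (rho t (m + 4) - 1 + α) / (1 + rho t (m + 4)) ^ α
          - 2 * rho t (m + 4) ^ (2 - α) / (1 + rho t (m + 4)) = F at *
  have e : α / A * (F - y * (y - 2) / (1 + y)) / ((1 - α) * (2 - α))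
      = α / ((1 - α) * (2 - α) * A) * (F + 2 * y / (1 + y))
        - α * (y ^ 2 / (1 + y)) / ((1 - α) * (2 - α) * A) := by
    field_simp
    ring
  rw [e, ha]
  linarith

theorem g_last_le (hα0 : 0 < α) (hα1 : α < 1) (ht : StrictMono t)
    (hr : ∀ k, 2 ≤ k → RatioCondition t k) (m : ℕ) :
    g α t (m + 3) (m + 3) / ((1 - α) * (2 - α))
      ≤ diagUp α t (m + 1) - coefA α t (m + 3) (m + 3) := by
  have h := le_diag_last hα0 hα1 ht hr (m + 1)
  have ha := coefA_self hα1 ht (show 2 ≤ m + 3 by omega)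
  rw [g, if_neg (by omega), if_neg (lt_irrefl _), diagUp]
  simp only [show m + 1 + 2 = m + 3 by omega, show m + 1 + 1 = m + 2 by omega] at h ⊢
  have hA : 0 < tau t (m + 3) ^ α := Real.rpow_pos_of_pos (tau_pos ht (by omega)) _
  have hy := rho_pos ht (show 2 ≤ m + 3 by omega)
  have a1 : 0 < 1 - α := by linarith
  have a2 : 0 < 2 - α := by linarith
  generalize rho t (m + 3) = y at *
  generalize tau t (m + 3) ^ α = A at *
  have e : α / A * ((1 + α) * (2 - α) / α - y * (y - 2) / (1 + y)) / ((1 - α) * (2 - α))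
      = α / ((1 - α) * (2 - α) * A) * ((1 + α) * (2 - α) / α + 2 * y / (1 + y))
        - α * (y ^ 2 / (1 + y)) / ((1 - α) * (2 - α) * A) := by
    field_simp
    ring
  rw [e, ha]
  linarith

theorem gHat_mul_le (w₀ w₁ : ℝ) : gHat α t * (w₀ ^ 2 + w₁ ^ 2)
    ≤ matC α t 0 0 * w₀ ^ 2 + 2 * (-coefA α t 2 2) * w₀ * w₁ + matC α t 1 1 * w₁ ^ 2 := by
  have := smallEigenvalue_mul_le (matC α t 0 0) (-coefA α t 2 2) (matC α t 1 1) w₀ w₁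
  rwa [neg_mul_neg, ← gHat_eq] at this

theorem sum_g_le_gamma_mul (hα0 : 0 < α) (hα1 : α < 1) (ht : StrictMono t)
    (hr : ∀ k, 2 ≤ k → RatioCondition t k) (v w : ℕ → ℝ) (hw : ∀ i, w i = v (i + 1) - v i)
    (m : ℕ) :
    ∑ i ∈ Finset.range (m + 2), g α t (m + 2) (i + 1) / ((1 - α) * (2 - α)) * w i ^ 2
    ≤ 2 * (Real.Gamma (1 - α) * ∑ i ∈ Finset.range (m + 2), fracL2 α t v (i + 1) * w i) := by
  refine le_trans ?_ (gamma_mul_sum_fracL2_ge hα0 hα1 ht hr v w hw m)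
  have a1 : 0 < 1 - α := by linarith
  have a2 : 0 < 2 - α := by linarith
  have h0 : 0 ≤ ∑ p ∈ Finset.range (m + 1),
        (kerD t (ker α t (m + 2)) (p + 1) - kerD t (ker α t (m + 2)) p)
          * (∑ i ∈ Finset.Ico p (m + 2), w i) ^ 2 := by
    apply Finset.sum_nonneg
    intro p hp
    rw [Finset.mem_range] at hp
    exact mul_nonneg (kerD_ker_succ_sub_nonneg hα0 ht hr (by omega)) (sq_nonneg _)
  have hC := gHat_mul_le (α := α) (t := t) (w 0) (w 1)
  have hg : ∀ k, k ≤ 2 → g α t (m + 2) k / ((1 - α) * (2 - α)) = gHat α t := by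
    intro k hk
    rw [g, if_pos hk]
    field_simp
  rw [Finset.sum_range_succ', Finset.sum_range_succ', hg _ (by omega), hg _ (by omega)]
  simp only [zero_add, add_assoc, Nat.reduceAdd]
  -- For n = 2 the added-back share of row 3 is simply dropped. For n ≥ 3 it cancels the deduction
  -- in the last diagonal coefficient, which is why g_n has no ρ_{n+1} terms.
  match m with
  | 0 =>
    have := mul_nonneg (diagDown_nonneg hα0 hα1 ht hr 0) (sq_nonneg (w 1))
    simp only [Finset.range_zero, Finset.sum_empty, zero_add] at *
    linarith
  | m + 1 =>
    have e1 := Finset.sum_range_succ (fun i =>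
      g α t (m + 1 + 2) (i + 3) / ((1 - α) * (2 - α)) * w (i + 2) ^ 2) m
    have e2 := Finset.sum_range_succ (fun i =>
      (diagUp α t (i + 1) - coefA α t (i + 3) (i + 3) - diagDown α t (i + 1)) * w (i + 2) ^ 2) m
    have h1 : ∑ i ∈ Finset.range m, g α t (m + 1 + 2) (i + 3) / ((1 - α) * (2 - α)) * w (i + 2) ^ 2
        ≤ ∑ i ∈ Finset.range m,
          (diagUp α t (i + 1) - coefA α t (i + 3) (i + 3) - diagDown α t (i + 1)) * w (i + 2) ^ 2 := by
      apply Finset.sum_le_sum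
      intro i hi
      rw [Finset.mem_range] at hi
      exact mul_le_mul_of_nonneg_right (g_mid_le hα0 hα1 ht hr (by omega)) (sq_nonneg _)
    have h2 := mul_le_mul_of_nonneg_right (g_last_le hα0 hα1 ht hr m) (sq_nonneg (w (m + 2)))
    simp only [add_assoc, Nat.reduceAdd] at *
    linarith

theorem sum_Icc_one_eq_sum_range (f : ℕ → ℝ) (n : ℕ) :
    ∑ k ∈ Finset.Icc 1 n, f k = ∑ i ∈ Finset.range n, f (i + 1) := by
  induction n with
  | zero => simp
  | succ n ih => rw [Finset.sum_Icc_succ_top (by omega), ih, Finset.sum_range_succ]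

theorem sum_g_le_sum_fracL2 (hα0 : 0 < α) (hα1 : α < 1) (ht : StrictMono t)
    (hr : ∀ k, 2 ≤ k → RatioCondition t k) (v : ℕ → ℝ) {n : ℕ} (hn : 2 ≤ n) :
    ∑ k ∈ Finset.Icc 1 n, g α t n k / (2 * Real.Gamma (3 - α)) * (v k - v (k - 1)) ^ 2
      ≤ ∑ k ∈ Finset.Icc 1 n, fracL2 α t v k * (v k - v (k - 1)) := by
  obtain ⟨m, rfl⟩ : ∃ m, n = m + 2 := ⟨n - 2, by omega⟩
  have h := sum_g_le_gamma_mul hα0 hα1 ht hr v (fun i => v (i + 1) - v i) (fun _ => rfl) m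
  rw [sum_Icc_one_eq_sum_range, sum_Icc_one_eq_sum_range]
  simp only [Nat.add_sub_cancel]
  have hG := Real.Gamma_pos_of_pos (show 0 < 1 - α by linarith)
  have a1 : 0 < 1 - α := by linarith
  have a2 : 0 < 2 - α := by linarith
  have hG3 : Real.Gamma (3 - α) = (2 - α) * ((1 - α) * Real.Gamma (1 - α)) := by
    rw [show 3 - α = (1 - α + 1) + 1 by ring, Real.Gamma_add_one (by linarith),
      Real.Gamma_add_one a1.ne']
    ring
  rw [← mul_assoc, ← div_le_iff₀' (by positivity), Finset.sum_div] at h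
  refine le_trans (le_of_eq ?_) h
  apply Finset.sum_congr rfl
  intro i _
  rw [hG3]
  field_simp

/-! ### Integration over the domain -/

theorem memLp_fracL2 {E : Type*} [MeasurableSpace E] {μ : Measure E} (hα1 : α < 1)
    (ht : StrictMono t) (f : ℕ → E → ℝ) {n : ℕ} (hf : ∀ k ≤ n, MemLp (f k) 2 μ) {k : ℕ}
    (hk : 1 ≤ k) (hkn : k ≤ n) : MemLp (fun x => fracL2 α t (fun j => f j x) k) 2 μ := by
  have hG : Real.Gamma (1 - α) ≠ 0 := (Real.Gamma_pos_of_pos (by linarith)).ne'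
  have hd : ∀ i, i + 1 ≤ n → MemLp (fun x => f (i + 1) x - f i x) 2 μ := fun i hi =>
    (hf _ hi).sub (hf _ (by omega))
  have e : (fun x => fracL2 α t (fun j => f j x) k)
      = fun x => (Real.Gamma (1 - α))⁻¹ * (Real.Gamma (1 - α) * fracL2 α t (fun j => f j x) k) := by
    ext x
    field_simp
  rw [e]
  apply MemLp.const_mul
  match k with
  | 1 =>
    simp only [gamma_mul_fracL2_one hα1 ht]
    exact (hd 0 hkn).const_mul _
  | k + 2 =>
    simp only [gamma_mul_fracL2 hα1 ht]
    have hs : MemLp (fun x => ∑ p ∈ Finset.range (k + 1),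
        kerD t (ker α t (k + 2)) (p + 1) * (f (p + 1) x - f p x)) 2 μ := by
      apply memLp_finsetSum
      intro p hp
      rw [Finset.mem_range] at hp
      exact (hd p (by omega)).const_mul _
    have h1 := (hd k (by omega)).const_mul (coefA α t (k + 2) (k + 2))
    have h2 := (hd (k + 1) (by omega)).const_mul
      (coefC α t (k + 2) (k + 1) + coefC α t (k + 2) (k + 2))
    exact (hs.sub h1).add h2

theorem l2Norm_sq {d : ℕ} (Ω : Set (EuclideanSpace ℝ (Fin d)))
    (f : EuclideanSpace ℝ (Fin d) → ℝ) : l2Norm Ω f ^ 2 = ∫ x in Ω, f x ^ 2 := by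
  have h : l2Inner Ω f f = ∫ x in Ω, f x ^ 2 := by simp only [l2Inner, sq]
  rw [l2Norm, Real.sq_sqrt, h]
  rw [h]
  exact integral_nonneg fun x => sq_nonneg _

theorem sum_g_le_bilinB {d : ℕ} (Ω : Set (EuclideanSpace ℝ (Fin d))) (hα0 : 0 < α) (hα1 : α < 1)
    (ht : StrictMono t) (hr : ∀ k, 2 ≤ k → RatioCondition t k) {n : ℕ} (hn : 2 ≤ n)
    (u : ℝ → EuclideanSpace ℝ (Fin d) → ℝ)
    (hu : ∀ k ≤ n, MemLp (u (t k)) 2 (volume.restrict Ω)) :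
    ∑ k ∈ Finset.Icc 1 n, g α t n k / (2 * Real.Gamma (3 - α)) * l2Norm Ω (delta t u k) ^ 2
      ≤ bilinB Ω α t n u u := by
  have hδ : ∀ k ∈ Finset.Icc 1 n, MemLp (delta t u k) 2 (volume.restrict Ω) := by
    intro k hk
    rw [Finset.mem_Icc] at hk
    exact (hu k hk.2).sub (hu (k - 1) (by omega))
  have hL : ∀ k ∈ Finset.Icc 1 n,
      Integrable (fun x => fracL2Fun α t u k x * delta t u k x) (volume.restrict Ω) := by
    intro k hk
    have hk' := Finset.mem_Icc.1 hk
    exact MemLp.integrable_mul (memLp_fracL2 hα1 ht (fun j => u (t j)) hu hk'.1 hk'.2) (hδ k hk)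
  have hS : ∀ k ∈ Finset.Icc 1 n, Integrable (fun x => g α t n k / (2 * Real.Gamma (3 - α))
      * delta t u k x ^ 2) (volume.restrict Ω) := fun k hk => (hδ k hk).integrable_sq.const_mul _
  simp only [bilinB, l2Inner, l2Norm_sq, ← integral_const_mul]
  rw [← integral_finsetSum _ hS, ← integral_finsetSum _ hL]
  exact integral_mono (integrable_finsetSum _ hS) (integrable_finsetSum _ hL) fun x =>
    sum_g_le_sum_fracL2 hα0 hα1 ht hr (fun j => u (t j) x) hn

end

end L2Frac

end

theorem corollary3p3 {d : ℕ} (Ω : Set (EuclideanSpace ℝ (Fin d))) (hΩ : MeasurableSet Ω)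
    (α : ℝ) (hα0 : 0 < α) (hα1 : α < 1)
    (t : ℕ → ℝ) (ht0 : t 0 = 0) (ht : StrictMono t)
    (hρ : ∀ k : ℕ, 2 ≤ k → L2Frac.rho t k ∈ Set.Icc L2Frac.rhoL L2Frac.rhoR) :
    L2Frac.InitialConstraint t ∧ (∀ k : ℕ, 3 ≤ k → L2Frac.StepConstraint t k) ∧
    ∀ n : ℕ, 2 ≤ n →
      (∀ k ∈ Finset.Icc 1 n, 0 < L2Frac.g α t n k) ∧
      ∀ u : ℝ → EuclideanSpace ℝ (Fin d) → ℝ,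
        (∀ k : ℕ, k ≤ n → MemLp (u (t k)) 2 (volume.restrict Ω)) →
        L2Frac.bilinB Ω α t n u u ≥
            ∑ k ∈ Finset.Icc 1 n, L2Frac.g α t n k / (2 * Real.Gamma (3 - α))
              * L2Frac.l2Norm Ω (L2Frac.delta t u k) ^ 2 ∧
        ∑ k ∈ Finset.Icc 1 n, L2Frac.g α t n k / (2 * Real.Gamma (3 - α))
              * L2Frac.l2Norm Ω (L2Frac.delta t u k) ^ 2 ≥ 0 := by
  have hr : ∀ k, 2 ≤ k → L2Frac.RatioCondition t k := fun k hk =>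
    L2Frac.ratioCondition_of_mem hρ hk
  refine ⟨L2Frac.initialConstraint_of_mem hρ,
    fun k hk => L2Frac.stepConstraint_of_mem hρ (by omega), fun n hn => ?_⟩
  have hg : ∀ k ∈ Finset.Icc 1 n, 0 < L2Frac.g α t n k := fun k hk =>
    L2Frac.g_pos hα0 hα1 ht hρ n (Finset.mem_Icc.1 hk).1
  refine ⟨hg, fun u hu => ⟨L2Frac.sum_g_le_bilinB Ω hα0 hα1 ht hr hn u hu, ?_⟩⟩
  have hG := Real.Gamma_pos_of_pos (show 0 < 3 - α by linarith)
  exact Finset.sum_nonneg fun k hk =>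
    mul_nonneg (div_nonneg (hg k hk).le (by positivity)) (sq_nonneg _)
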